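/- Let $a\in\mathbb R$ with $a^2>2$, let $\zeta\ge 0$, and put $\mathfrak p(t)=2(2-a^2)t^2-a^2$ (which has no real zeros), $M=\begin{pmatrix}0&0\\0&1\end{pmatrix}$, $$\mathcal W_a(t)=\frac{e^{-t^2}}{\mathfrak p^2(t)}\begin{pmatrix}\frac{a^2}{4(a^2-2)}\mathfrak p(t)^2+\frac{\mathfrak p(t)}{a^2-2}-a^2 & a\left(\frac{\mathfrak p(t)}{a^2-2}-2\right)t\\ a\left(\frac{\mathfrak p(t)}{a^2-2}-2\right)t&\frac{2(a^2(a^2-2)-\mathfrak p(t))}{(a^2-2)^2}\end{pmatrix},\qquad \mathcal W_{a,\zeta}=\frac1{\sqrt\pi}\mathcal W_a(t)\,dt+\zeta M\delta_0 .$$ Let $\mathcal D(y)=y''\mathcal F_2+y'\mathcal F_1+y\mathcal F_0$ (independent of $\zeta$), with coefficients rational and without real poles, $$\mathcal F_2(t)=\frac1{\mathfrak p(t)}\begin{pmatrix}-a^2(2t^2+1)&-(a^2-2)at(2t^2+1)\\ \frac{4at}{a^2-2}&4t^2\end{pmatrix},\qquad \mathcal F_0=\begin{pmatrix}2-\frac4{a^2}&0\\0&0\end{pmatrix},$$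 $$\mathcal F_1(t)=\frac1{\mathfrak p^2(t)}\begin{pmatrix}-2t(\mathfrak p^2(t)+4\mathfrak p(t)-4a^2)&\frac{4(a^2-2)t^2}{a}(-\mathfrak p(t)+2a^2)\\ \frac{4(\mathfrak p(t)+2a^2)(\mathfrak p(t)-a^2)}{a(a^2-2)}&-8a^2t\end{pmatrix}.$$ With $H_n$ the Hermite polynomials $H_n(t)=(-1)^ne^{t^2}(e^{-t^2})^{(n)}$, let $$P_n(t)=H_n(t)\begin{pmatrix}1&0\\0&1-a^2\end{pmatrix}+nH_{n-1}(t)\begin{pmatrix}0&-a\\-a&a^2t\end{pmatrix},\qquad \mathcal P_n=-P_n+P_n'(P_1')^{-1}P_1,$$ and let $\mathbb A=\{\sum_{n\ne1}A_n\mathcal P_n\ \text{(finite sums)}:A_n\in\mathbb R^{2\times2}\}$ be the left linear span of the $\mathcal P_n$, $n\neq1$. Then $\mathcal W_{a,\zeta}$ is a weight matrix (finite moments of all orders, positive semidefinite on every Borel set, positive definite on at least one, infinite support). The operator $\mathcal D$ maps $\mathbb A$ into matrix polynomials and is symmetric with respect to $(\mathcal W_{a,\zeta},\mathbb A)$: $\int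 \mathcal D(P)\,d\mathcal W_{a,\zeta}\,Q^*=\int P\,d\mathcal W_{a,\zeta}\,\mathcal D(Q)^*$ for $P,Q\in\mathbb A$. Moreover, there are matrix polynomials $\mathcal P_n^\zeta$, $n\in\mathbb N\setminus\{1\}$, with $\mathcal P_n^\zeta$ of degree $n$ and leading coefficient the identity, such that: 1. $\int \mathcal P_n^\zeta\,d\mathcal W_{a,\zeta}\,(\mathcal P_k^\zeta)^*=0$ for $n\ne k$, and it is positive definite for $n=k$. 2. The left linear span of the $\mathcal P^\zeta_n$, $n\ne1$, is dense in $L^2(\mathcal W_{a,\zeta})$. 3. For each $n\ne1$ there is $\Gamma_n\in\mathbb R^{2\times2}$ with $\mathcal D(\mathcal P_n^\zeta)=\Gamma_n\mathcal P_n^\zeta$. 4. Each $\mathcal P_n^\zeta$ is a left linear combination of the $\mathcal P_k$ with $k\le n$, $k\ne1$, and the left linear span of all $\mathcal P_n^\zeta$, $n\neq1$, is $\mathbb A$. For $\zeta=0$, $\mathcal P_n^0=K_n\mathcal P_n$ with $K_n$ a nonsingular constant matrix. 5. $\mathcal P_0^\zeta=I$, and $$\mathcal P_2^\zeta(t)=\begin{pmatrix}t^2-\frac{a^2+2}{2a^2-4}&-at\\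 \frac{2at}{a^2-2}&t^2+\frac1{2(\zeta(a^2-2)^2+1)}\end{pmatrix},\qquad \mathcal P_3^\zeta(t)=\begin{pmatrix}t^3-\frac{3a^2t}{2a^2-4}&\frac{-3at^2}{2}\\ \frac{6at^2}{a^4-4}&t^3+\frac{3a^2t}{2a^2+4}\end{pmatrix}.$$ In particular, for every $\zeta\ge0$, the $\mathcal P_n^\zeta$, $n\ne1$, are exceptional matrix polynomials for $\mathcal W_{a,\zeta}$ and the fixed operator $\mathcal D$. -/

import Mathlib

open MeasureTheory

namespace ExceptionalMatrix

/-- The space `ℝ^{N×N}[t]` of matrix polynomials `P(t) = A_n t^n + ⋯ + A_0`. -/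
abbrev MatPoly (N : ℕ) := Polynomial (Matrix (Fin N) (Fin N) ℝ)

/-- The value `P(t)` of a matrix polynomial at the real number `t`. -/
noncomputable def value {N : ℕ} (P : MatPoly N) (t : ℝ) : Matrix (Fin N) (Fin N) ℝ :=
  P.eval (Matrix.scalar (Fin N) t)

/-- The matrix of measures `dW = H dμ` on the real line, given by a scalar Borel measure `μ` (`base`)
and a matrix density `H` (`density`). Every matrix of finite measures has such a representation,
for instance with `μ` the sum of the total variations of the entries. -/
structure MatrixMeasure (N : ℕ) where
  base : Measure ℝ
  density : ℝ → Matrix (Fin N) (Fin N) ℝ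

namespace MatrixMeasure

variable {N : ℕ}

/-- The matrix `W(Ω)`. -/
noncomputable def mass (W : MatrixMeasure N) (Ω : Set ℝ) : Matrix (Fin N) (Fin N) ℝ :=
  Matrix.of fun i j => ∫ t in Ω, W.density t i j ∂W.base

/-- The support `{x : W((x-ε,x+ε)) ≠ 0 for every ε > 0}`. -/
def supp (W : MatrixMeasure N) : Set ℝ :=
  {x | ∀ ε : ℝ, 0 < ε → W.mass (Set.Ioo (x - ε) (x + ε)) ≠ 0}

/-- Weight matrices: all moments are finite (the zeroth one says that the entries of `W` are finite
measures), `W(Ω)` is positive semidefinite for every Borel set and positive definite for at least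
one of them, and the support is infinite. -/
structure IsWeight (W : MatrixMeasure N) : Prop where
  moments : ∀ (n : ℕ) (i j : Fin N), Integrable (fun t => t ^ n * W.density t i j) W.base
  posSemidef : ∀ Ω : Set ℝ, MeasurableSet Ω → (W.mass Ω).PosSemidef
  posDef : ∃ Ω : Set ℝ, MeasurableSet Ω ∧ (W.mass Ω).PosDef
  infinite_supp : W.supp.Infinite

/-- `∫ F(t) dW(t) G(t)^*`, an `N × N` matrix. -/
noncomputable def inner (W : MatrixMeasure N) (F G : ℝ → Matrix (Fin N) (Fin N) ℝ) :
    Matrix (Fin N) (Fin N) ℝ :=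
  Matrix.of fun i j => ∫ t, (F t * W.density t * (G t).transpose) i j ∂W.base

/-- The squared norm `∫ tr (F(t) dW(t) F(t)^*)` of the space `L²(W)`, with values in `[0, ∞]`. -/
noncomputable def normSq (W : MatrixMeasure N) (F : ℝ → Matrix (Fin N) (Fin N) ℝ) : ENNReal :=
  ∫⁻ t, ENNReal.ofReal (F t * W.density t * (F t).transpose).trace ∂W.base

/-- A set of matrix polynomials is dense in `L²(W)`. -/
def DenseInL2 (W : MatrixMeasure N) (S : Set (MatPoly N)) : Prop :=
  ∀ F : ℝ → Matrix (Fin N) (Fin N) ℝ, (∀ i j, Measurable fun t => F t i j) → W.normSq F < ⊤ →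
    ∀ ε : ENNReal, 0 < ε → ∃ Q ∈ S, W.normSq (fun t => F t - value Q t) < ε

end MatrixMeasure

/-- A right-hand side differential operator `y ↦ y'' F₂ + y' F₁ + y F₀`. -/
structure DiffOp (N : ℕ) where
  F2 : ℝ → Matrix (Fin N) (Fin N) ℝ
  F1 : ℝ → Matrix (Fin N) (Fin N) ℝ
  F0 : ℝ → Matrix (Fin N) (Fin N) ℝ

/-- The function `𝒟(P)` for a matrix polynomial `P`. -/
noncomputable def DiffOp.app {N : ℕ} (D : DiffOp N) (P : MatPoly N) (t : ℝ) :
    Matrix (Fin N) (Fin N) ℝ :=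
  value (Polynomial.derivative (Polynomial.derivative P)) t * D.F2 t
    + value (Polynomial.derivative P) t * D.F1 t + value P t * D.F0 t

/-- `F` is a rational matrix function without real poles. -/
def IsRegularRational {N : ℕ} (F : ℝ → Matrix (Fin N) (Fin N) ℝ) : Prop :=
  ∃ (q : Polynomial ℝ) (R : MatPoly N),
    ∀ t : ℝ, q.eval t ≠ 0 ∧ F t = (q.eval t)⁻¹ • value R t

/-- The (left) linear span `{∑ A_n P_n : A_n ∈ ℝ^{N×N}}`, finite sums over indices `n ∉ X`. -/
noncomputable def leftSpan {N : ℕ} (X : Set ℕ) (P : ℕ → MatPoly N) :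
    Submodule (Matrix (Fin N) (Fin N) ℝ) (MatPoly N) :=
  Submodule.span (Matrix (Fin N) (Fin N) ℝ) (P '' Xᶜ)

/-- The matrix polynomials `P_n`, `n ∉ X`, are exceptional (orthogonal) matrix polynomials with
respect to the weight matrix `W`, with second order differential operator `D`. The values `P n` for
`n ∈ X` play no role. -/
structure IsExceptional {N : ℕ} (X : Finset ℕ) (W : MatrixMeasure N) (D : DiffOp N)
    (P : ℕ → MatPoly N) : Prop where
  degree : ∀ n ∉ X, (P n).natDegree = n ∧ IsUnit (P n).leadingCoeff
  weight : W.IsWeight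
  orthogonal : ∀ n ∉ X, ∀ k ∉ X, n ≠ k → W.inner (value (P n)) (value (P k)) = 0
  norm_posDef : ∀ n ∉ X, (W.inner (value (P n)) (value (P n))).PosDef
  complete : W.DenseInL2 (leftSpan (X : Set ℕ) P)
  order_two : D.F2 ≠ 0
  rational : IsRegularRational D.F2 ∧ IsRegularRational D.F1 ∧ IsRegularRational D.F0
  eigen : ∀ n ∉ X, ∃ Γ : Matrix (Fin N) (Fin N) ℝ, ∀ t, D.app (P n) t = Γ * value (P n) t

/-- `D` maps the space `A` of matrix polynomials into matrix polynomials and is symmetric with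
respect to the pair `(W, A)`. -/
def IsSymmetricOn {N : ℕ} (D : DiffOp N) (W : MatrixMeasure N)
    (A : Submodule (Matrix (Fin N) (Fin N) ℝ) (MatPoly N)) : Prop :=
  (∀ P ∈ A, ∃ Q : MatPoly N, ∀ t, D.app P t = value Q t) ∧
    ∀ P ∈ A, ∀ Q ∈ A, W.inner (D.app P) (value Q) = W.inner (value P) (D.app Q)

/-- `𝔭(t) = 2(2-a²)t² - a²`. -/
noncomputable def pfun (a t : ℝ) : ℝ := 2 * (2 - a ^ 2) * t ^ 2 - a ^ 2

/-- The matrix function `𝒲_a(t)`. -/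
noncomputable def Wa (a t : ℝ) : Matrix (Fin 2) (Fin 2) ℝ :=
  (Real.exp (-t ^ 2) / pfun a t ^ 2) •
    !![a ^ 2 / (4 * (a ^ 2 - 2)) * pfun a t ^ 2 + pfun a t / (a ^ 2 - 2) - a ^ 2,
        a * (pfun a t / (a ^ 2 - 2) - 2) * t;
       a * (pfun a t / (a ^ 2 - 2) - 2) * t,
        2 * (a ^ 2 * (a ^ 2 - 2) - pfun a t) / (a ^ 2 - 2) ^ 2]

/-- `M = diag(0,1)`. -/
def Mmat : Matrix (Fin 2) (Fin 2) ℝ := !![0, 0; 0, 1]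

/-- The matrix of measures `𝒲_a(t)dt/√π + ζ M δ₀`, written as a density with respect to `dt + ζ δ₀`:
the density is `M` at the (Lebesgue null) point `0` and `𝒲_a(t)/√π` elsewhere. -/
noncomputable def Waζ (a ζ : ℝ) : MatrixMeasure 2 where
  base := volume + ENNReal.ofReal ζ • Measure.dirac 0
  density := fun t => if t = 0 then Mmat else (1 / Real.sqrt Real.pi) • Wa a t

/-- The operator `𝒟(y) = y'' 𝓕₂ + y' 𝓕₁ + y 𝓕₀`; it depends on `a` only. -/
noncomputable def Da (a : ℝ) : DiffOp 2 where
  F2 := fun t => (1 / pfun a t) •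
    !![-a ^ 2 * (2 * t ^ 2 + 1), -(a ^ 2 - 2) * a * t * (2 * t ^ 2 + 1);
       4 * a * t / (a ^ 2 - 2), 4 * t ^ 2]
  F1 := fun t => (1 / pfun a t ^ 2) •
    !![-2 * t * (pfun a t ^ 2 + 4 * pfun a t - 4 * a ^ 2),
        4 * (a ^ 2 - 2) * t ^ 2 / a * (-pfun a t + 2 * a ^ 2);
       4 * (pfun a t + 2 * a ^ 2) * (pfun a t - a ^ 2) / (a * (a ^ 2 - 2)),
        -8 * a ^ 2 * t]
  F0 := fun _ => !![2 - 4 / a ^ 2, 0; 0, 0]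

open Polynomial in
/-- The (physicists') Hermite polynomials `H_n(t) = (-1)^n e^{t²} (e^{-t²})^{(n)}`, by the
equivalent recursion `H_{n+1} = 2 t H_n - H_n'`. -/
noncomputable def hermiteH : ℕ → Polynomial ℝ
  | 0 => 1
  | n + 1 => 2 * X * hermiteH n - derivative (hermiteH n)

open Polynomial in
/-- A `2 × 2` matrix of real polynomials, as a matrix polynomial. -/
noncomputable def ofEntries (A : Matrix (Fin 2) (Fin 2) (Polynomial ℝ)) : MatPoly 2 :=
  matPolyEquiv A

open Polynomial in
/-- The Hermite type matrix polynomials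
`P_n = H_n diag(1,ξ) + n H_{n-1} [[0,-a],[-a,a²t]]` with `ξ = 1 - a²`. -/
noncomputable def hermitePn (a : ℝ) (n : ℕ) : MatPoly 2 :=
  ofEntries !![hermiteH n, -(n : ℝ[X]) * C a * hermiteH (n - 1);
    -(n : ℝ[X]) * C a * hermiteH (n - 1),
    C (1 - a ^ 2) * hermiteH n + (n : ℝ[X]) * C (a ^ 2) * X * hermiteH (n - 1)]

open Polynomial in
/-- The first order operator `𝒜(y) = -y + y' (P_1')⁻¹ P_1`, where `P_1' = diag(2, 2 - a²)`. -/
noncomputable def opA (a : ℝ) (y : MatPoly 2) : MatPoly 2 :=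
  -y + derivative y * C (!![2, 0; 0, 2 - a ^ 2]⁻¹) * hermitePn a 1

/-- The exceptional polynomials `𝒫_n = 𝒜(P_n)`, `n ≠ 1`, of the weight `𝒲_a`. -/
noncomputable def excP (a : ℝ) (n : ℕ) : MatPoly 2 := opA a (hermitePn a n)

end ExceptionalMatrix

/-!
The exceptional polynomials come from the Hermite type polynomials `P_n` by a Darboux
transformation. With `K(t) = (P₁')⁻¹ P₁ = t + N` one has `𝒜(y) = y' K - y`, hence
`𝒜(y)' = y'' K`. As evaluation at `-N` (to the right of the coefficients) kills the left multiples
of `K`, the range of `𝒜` lies in the space `excSpace` of the `P` with `P'(-N) = 0`. This space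
contains an element `𝒫_n` of each degree `n ≠ 1` with invertible leading coefficient and none of
degree one, so degree reduction (`mem_span_of_degree_lt`) shows that any such family in it is a
graded basis. The operator `𝒜` intertwines `𝒟` with a second order operator `opE` that has
polynomial coefficients and does not raise degrees (`app_opA`); thus `𝒟` maps `excSpace` to itself
without raising degrees.

The symmetry of `𝒟` holds on all matrix polynomials. For the absolutely continuous part this is
Green's formula, the boundary terms being killed by the Gaussian factor. It rests on the three
symmetry equations: `S = 𝓕₂ 𝒲ₐ` is symmetric, `Y = 𝓕₁ 𝒲ₐ - S'` is skew-symmetric, and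
`Y' = 𝓕₀ 𝒲ₐ - 𝒲ₐ 𝓕₀ᵀ`. A mass `ζ M` at the origin does no harm since `𝓕ᵢ(0) M = 0` for all three
coefficients, so `𝒟(P)(0) M = 0` (`inner_app`).

The matrix `𝒲ₐ(t)` is positive definite, so the inner product on polynomials is definite and
Gram-Schmidt orthogonalization inside `excSpace` yields monic orthogonal `orthP a ζ n`, `n ≠ 1`.
As `𝒟` is symmetric and preserves the degree filtration, they are eigenfunctions
(`exists_eigenvalue_orthP`). For `ζ = 0` the `𝒫_n` themselves are orthogonal: integration by parts
moves `𝒜` from `𝒫_n = 𝒜(P_n)` to the other factor (`innerWa_opA`), and the `P_n` are orthogonal to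
all polynomials of lower degree with respect to `hermiteWeight`. Uniqueness of monic orthogonal
elements (`eq_orthP`) gives the explicit form in degree two and three.

For completeness (`denseInL2_of_factor`), the density is factored as `T Tᵀ`, which embeds `L²(W)` in
a space of square integrable vector functions. The roots of `𝔭` are the eigenvalues of `-N`, so
`excSpace` contains all multiples of `𝔭²`. An element orthogonal to these leads to functions that
are integrable against all exponentials and whose moments all vanish. Such functions are zero
(`ae_eq_zero_of_moments`), as the Laplace transforms of their positive and negative parts are entire
functions with the same Taylor coefficients.
-/

namespace ExceptionalMatrix

open Polynomial

/-! ### Values of matrix polynomials -/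

section Value

variable {N : ℕ}

/-- Entrywise description of the value of a matrix polynomial through its matrix of scalar
polynomials. -/
lemma value_apply (P : MatPoly N) (t : ℝ) (i j : Fin N) :
    value P t i j = (matPolyEquiv.symm P i j).eval t := by
  conv_lhs => rw [← matPolyEquiv.apply_symm_apply P]
  exact matPolyEquiv_eval _ _ _ _

lemma value_add (P Q : MatPoly N) (t : ℝ) : value (P + Q) t = value P t + value Q t :=
  eval_add

lemma value_sub (P Q : MatPoly N) (t : ℝ) : value (P - Q) t = value P t - value Q t :=
  eval_sub _ _ _

lemma value_C (A : Matrix (Fin N) (Fin N) ℝ) (t : ℝ) : value (C A) t = A :=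
  eval_C

lemma value_zero (t : ℝ) : value (0 : MatPoly N) t = 0 :=
  eval_zero

lemma value_one (t : ℝ) : value (1 : MatPoly N) t = 1 :=
  eval_one

lemma value_X (t : ℝ) : value (X : MatPoly N) t = t • (1 : Matrix (Fin N) (Fin N) ℝ) := by
  rw [value, eval_X, Matrix.smul_one_eq_diagonal, Matrix.scalar_apply]

lemma value_mul (P Q : MatPoly N) (t : ℝ) : value (P * Q) t = value P t * value Q t := by
  ext i j
  simp only [value_apply, Matrix.mul_apply, map_mul, eval_finsetSum, eval_mul]

lemma value_smul (A : Matrix (Fin N) (Fin N) ℝ) (P : MatPoly N) (t : ℝ) :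
    value (A • P) t = A * value P t := by
  rw [← C_mul', value_mul, value_C]

lemma value_ofEntries (A : Matrix (Fin 2) (Fin 2) ℝ[X]) (t : ℝ) :
    value (ofEntries A) t = Matrix.of fun i j => (A i j).eval t := by
  ext i j
  exact matPolyEquiv_eval _ _ _ _

lemma symm_derivative (P : MatPoly N) (i j : Fin N) :
    matPolyEquiv.symm (derivative P) i j = derivative (matPolyEquiv.symm P i j) := by
  ext k
  simp only [matPolyEquiv_symm_apply_coeff, coeff_derivative]
  rw [← Nat.cast_succ, ← Nat.cast_succ, ← nsmul_eq_mul', ← nsmul_eq_mul', Matrix.smul_apply]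

lemma matPoly_ext {P Q : MatPoly N} (h : ∀ t, value P t = value Q t) : P = Q := by
  apply matPolyEquiv.symm.injective
  refine Matrix.ext fun i j => Polynomial.funext fun t => ?_
  rw [← value_apply, ← value_apply, h]

end Value

/-! ### Entrywise derivatives of matrix functions -/

section Deriv

variable {N : ℕ} {F F' G G' : ℝ → Matrix (Fin N) (Fin N) ℝ}

/-- `F'` is the derivative of the matrix function `F`, entry by entry. -/
def HasMatDeriv (F F' : ℝ → Matrix (Fin N) (Fin N) ℝ) : Prop :=
  ∀ t i j, HasDerivAt (fun s => F s i j) (F' t i j) t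

lemma hasMatDeriv_value (P : MatPoly N) : HasMatDeriv (value P) (value (derivative P)) := by
  intro t i j
  simp only [value_apply, symm_derivative]
  exact Polynomial.hasDerivAt _ _

lemma HasMatDeriv.add (hF : HasMatDeriv F F') (hG : HasMatDeriv G G') :
    HasMatDeriv (fun t => F t + G t) (fun t => F' t + G' t) :=
  fun t i j => (hF t i j).add (hG t i j)

lemma HasMatDeriv.sub (hF : HasMatDeriv F F') (hG : HasMatDeriv G G') :
    HasMatDeriv (fun t => F t - G t) (fun t => F' t - G' t) :=
  fun t i j => (hF t i j).sub (hG t i j)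

lemma HasMatDeriv.transpose (hF : HasMatDeriv F F') :
    HasMatDeriv (fun t => (F t).transpose) (fun t => (F' t).transpose) :=
  fun t i j => hF t j i

lemma HasMatDeriv.mul (hF : HasMatDeriv F F') (hG : HasMatDeriv G G') :
    HasMatDeriv (fun t => F t * G t) (fun t => F' t * G t + F t * G' t) := by
  intro t i j
  simp only [Matrix.mul_apply, Matrix.add_apply, ← Finset.sum_add_distrib]
  exact HasDerivAt.fun_sum fun k _ => (hF t i k).mul (hG t k j)

end Deriv

/-! ### Functions of exponential growth and Gaussian integrals -/

section Growth

/-- Continuous functions of at most exponential growth. They form an algebra that contains the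
polynomials and the exponentials `exp (c t)`, and their products with `exp (-t²)` are integrable. -/
def ExpGrowth (f : ℝ → ℝ) : Prop :=
  Continuous f ∧ ∃ C m : ℝ, ∀ t, |f t| ≤ C * Real.exp (m * |t|)

namespace ExpGrowth

variable {f g : ℝ → ℝ}

lemma exists_nonneg (hf : ExpGrowth f) :
    ∃ C m : ℝ, 0 ≤ C ∧ 0 ≤ m ∧ ∀ t, |f t| ≤ C * Real.exp (m * |t|) := by
  obtain ⟨-, C, m, h⟩ := hf
  refine ⟨|C|, |m|, abs_nonneg _, abs_nonneg _, fun t => (h t).trans ?_⟩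
  gcongr
  · exact le_abs_self C
  · exact le_abs_self m

lemma of_bounded (hf : Continuous f) (C : ℝ) (h : ∀ t, |f t| ≤ C) : ExpGrowth f :=
  ⟨hf, C, 0, fun t => by simpa using h t⟩

lemma const (c : ℝ) : ExpGrowth fun _ => c :=
  of_bounded continuous_const |c| fun _ => le_rfl

lemma id : ExpGrowth fun t => t :=
  ⟨continuous_id, 1, 1, fun t => by
    have := Real.add_one_le_exp |t|
    rw [one_mul, one_mul]; linarith⟩

lemma exp_mul (c : ℝ) : ExpGrowth fun t => Real.exp (c * t) :=
  ⟨by fun_prop, 1, |c|, fun t => by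
    rw [one_mul, Real.abs_exp, ← abs_mul]
    exact Real.exp_le_exp.2 (le_abs_self _)⟩

lemma add (hf : ExpGrowth f) (hg : ExpGrowth g) : ExpGrowth fun t => f t + g t := by
  obtain ⟨C, m, hC, hm, h⟩ := hf.exists_nonneg
  obtain ⟨C', m', hC', hm', h'⟩ := hg.exists_nonneg
  refine ⟨hf.1.add hg.1, C + C', m + m', fun t => (abs_add_le _ _).trans ?_⟩
  have := abs_nonneg t
  rw [add_mul C]
  refine add_le_add ((h t).trans ?_) ((h' t).trans ?_) <;> gcongr <;> linarith

lemma mul (hf : ExpGrowth f) (hg : ExpGrowth g) : ExpGrowth fun t => f t * g t := by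
  obtain ⟨C, m, hC, hm, h⟩ := hf.exists_nonneg
  obtain ⟨C', m', hC', hm', h'⟩ := hg.exists_nonneg
  refine ⟨hf.1.mul hg.1, C * C', m + m', fun t => ?_⟩
  rw [abs_mul, add_mul m, Real.exp_add, mul_mul_mul_comm]
  exact mul_le_mul (h t) (h' t) (abs_nonneg _) (by positivity)

lemma neg (hf : ExpGrowth f) : ExpGrowth fun t => -f t := by
  simpa using (const (-1)).mul hf

lemma sub (hf : ExpGrowth f) (hg : ExpGrowth g) : ExpGrowth fun t => f t - g t := by
  simpa only [sub_eq_add_neg] using hf.add hg.neg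

lemma pow (hf : ExpGrowth f) (n : ℕ) : ExpGrowth fun t => f t ^ n := by
  induction n with
  | zero => simpa using const 1
  | succ n ih => simpa only [pow_succ] using ih.mul hf

lemma sum {ι : Type*} (s : Finset ι) {f : ι → ℝ → ℝ} (h : ∀ i ∈ s, ExpGrowth (f i)) :
    ExpGrowth fun t => ∑ i ∈ s, f i t := by
  classical
  induction s using Finset.induction_on with
  | empty => simpa using const 0
  | insert i s hi ih =>
    simp only [Finset.sum_insert hi]
    exact (h i (Finset.mem_insert_self _ _)).add
      (ih fun j hj => h j (Finset.mem_insert_of_mem hj))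

lemma polynomial (p : ℝ[X]) : ExpGrowth fun t => p.eval t := by
  simp only [eval_eq_sum, Polynomial.sum]
  exact sum _ fun k _ => (const _).mul (id.pow k)

/-- Completing the square: `m|t| - t² ≤ m²/2 - t²/2`. -/
lemma integrable_gaussian (hf : ExpGrowth f) : Integrable fun t => Real.exp (-t ^ 2) * f t := by
  obtain ⟨C, m, hC, hm, h⟩ := hf.exists_nonneg
  have hint := (integrable_exp_neg_mul_sq (b := 1 / 2) (by norm_num)).const_mul
    (C * Real.exp (m ^ 2 / 2))
  refine hint.mono' ((by fun_prop : Continuous fun t : ℝ => Real.exp (-t ^ 2)).mul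
    hf.1).aestronglyMeasurable (Filter.Eventually.of_forall fun t => ?_)
  rw [Real.norm_eq_abs, abs_mul, Real.abs_exp]
  calc Real.exp (-t ^ 2) * |f t| ≤ Real.exp (-t ^ 2) * (C * Real.exp (m * |t|)) := by
        gcongr; exact h t
    _ = C * Real.exp (-t ^ 2 + m * |t|) := by rw [Real.exp_add]; ring
    _ ≤ C * Real.exp (m ^ 2 / 2 + -(1 / 2) * t ^ 2) := by
        refine mul_le_mul_of_nonneg_left (Real.exp_le_exp.2 ?_) hC
        nlinarith [sq_nonneg (m - |t|), sq_abs t]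
    _ = C * Real.exp (m ^ 2 / 2) * Real.exp (-(1 / 2) * t ^ 2) := by rw [Real.exp_add]; ring

end ExpGrowth

variable {N : ℕ}

/-- Matrix functions with entries of exponential growth. -/
def MatGrowth (F : ℝ → Matrix (Fin N) (Fin N) ℝ) : Prop :=
  ∀ i j, ExpGrowth fun t => F t i j

/-- Matrix functions `exp (-t²) F(t)` with `F` of exponential growth. -/
def GaussGrowth (F : ℝ → Matrix (Fin N) (Fin N) ℝ) : Prop :=
  ∃ G, MatGrowth G ∧ ∀ t, F t = Real.exp (-t ^ 2) • G t

variable {F F' G : ℝ → Matrix (Fin N) (Fin N) ℝ}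

namespace MatGrowth

lemma value (P : MatPoly N) : MatGrowth (value P) := fun i j => by
  simp only [value_apply]
  exact ExpGrowth.polynomial _

lemma const (A : Matrix (Fin N) (Fin N) ℝ) : MatGrowth fun _ => A :=
  fun _ _ => ExpGrowth.const _

lemma transpose (hF : MatGrowth F) : MatGrowth fun t => (F t).transpose :=
  fun i j => hF j i

lemma add (hF : MatGrowth F) (hG : MatGrowth G) : MatGrowth fun t => F t + G t :=
  fun i j => (hF i j).add (hG i j)

lemma sub (hF : MatGrowth F) (hG : MatGrowth G) : MatGrowth fun t => F t - G t :=
  fun i j => (hF i j).sub (hG i j)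

lemma mul (hF : MatGrowth F) (hG : MatGrowth G) : MatGrowth fun t => F t * G t := fun i j => by
  simp only [Matrix.mul_apply]
  exact ExpGrowth.sum _ fun k _ => (hF i k).mul (hG k j)

lemma smul {f : ℝ → ℝ} (hf : ExpGrowth f) (hG : MatGrowth G) : MatGrowth fun t => f t • G t :=
  fun i j => hf.mul (hG i j)

lemma mul_gauss (hF : MatGrowth F) (hG : GaussGrowth G) : GaussGrowth fun t => F t * G t := by
  obtain ⟨H, hH, h⟩ := hG
  exact ⟨_, hF.mul hH, fun t => by simp only [h, Matrix.mul_smul]⟩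

end MatGrowth

namespace GaussGrowth

lemma add (hF : GaussGrowth F) (hG : GaussGrowth G) : GaussGrowth fun t => F t + G t := by
  obtain ⟨H, hH, h⟩ := hF
  obtain ⟨H', hH', h'⟩ := hG
  exact ⟨_, hH.add hH', fun t => by simp only [h, h', smul_add]⟩

lemma sub (hF : GaussGrowth F) (hG : GaussGrowth G) : GaussGrowth fun t => F t - G t := by
  obtain ⟨H, hH, h⟩ := hF
  obtain ⟨H', hH', h'⟩ := hG
  exact ⟨_, hH.sub hH', fun t => by simp only [h, h', smul_sub]⟩

lemma mul (hF : GaussGrowth F) (hG : MatGrowth G) : GaussGrowth fun t => F t * G t := by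
  obtain ⟨H, hH, h⟩ := hF
  exact ⟨_, hH.mul hG, fun t => by simp only [h, Matrix.smul_mul]⟩

lemma integrable (hF : GaussGrowth F) (i j : Fin N) : Integrable fun t => F t i j := by
  obtain ⟨H, hH, h⟩ := hF
  simp only [h]
  exact (hH i j).integrable_gaussian

/-- The boundary terms in an integration by parts vanish. -/
lemma integral_deriv_eq_zero (hF : GaussGrowth F) (hF' : GaussGrowth F')
    (h : HasMatDeriv F F') (i j : Fin N) : ∫ t, F' t i j = 0 :=
  integral_eq_zero_of_hasDerivAt_of_integrable (fun t => h t i j) (hF'.integrable i j)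
    (hF.integrable i j)

end GaussGrowth

end Growth

/-! ### The weight and the symmetry equations -/

section Weight

variable {a : ℝ}

lemma pfun_le (ha : 2 < a ^ 2) (t : ℝ) : pfun a t ≤ -a ^ 2 := by
  rw [pfun]
  nlinarith [sq_nonneg t]

lemma pfun_neg (ha : 2 < a ^ 2) (t : ℝ) : pfun a t < 0 := by
  linarith [pfun_le ha t]

lemma pfun_ne_zero (ha : 2 < a ^ 2) (t : ℝ) : pfun a t ≠ 0 :=
  (pfun_neg ha t).ne

lemma hasDerivAt_pfun (a t : ℝ) : HasDerivAt (pfun a) (4 * (2 - a ^ 2) * t) t := by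
  have h := (((hasDerivAt_id t).pow 2).const_mul (2 * (2 - a ^ 2))).sub_const (a ^ 2)
  refine h.congr_deriv ?_
  norm_num
  ring

lemma continuous_pfun (a : ℝ) : Continuous (pfun a) := by
  unfold pfun
  fun_prop

lemma ExpGrowth.pfun (a : ℝ) : ExpGrowth (pfun a) :=
  ((ExpGrowth.const _).mul (ExpGrowth.id.pow 2)).sub (ExpGrowth.const _)

lemma ExpGrowth.inv_pfun (ha : 2 < a ^ 2) : ExpGrowth fun t => (ExceptionalMatrix.pfun a t)⁻¹ := by
  refine .of_bounded ((continuous_pfun a).inv₀ (pfun_ne_zero ha)) (a ^ 2)⁻¹ fun t => ?_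
  rw [abs_inv, abs_of_neg (pfun_neg ha t)]
  exact inv_anti₀ (by linarith) (by linarith [pfun_le ha t])

lemma ExpGrowth.div_pfun_pow (ha : 2 < a ^ 2) {f : ℝ → ℝ} (hf : ExpGrowth f) (k : ℕ) :
    ExpGrowth fun t => f t / ExceptionalMatrix.pfun a t ^ k := by
  simpa only [div_eq_mul_inv, inv_pow] using hf.mul ((ExpGrowth.inv_pfun ha).pow k)

/-- A matrix of real polynomials defines a matrix function of exponential growth. -/
lemma MatGrowth.of_polynomial (A : Matrix (Fin 2) (Fin 2) ℝ[X])
    {F : ℝ → Matrix (Fin 2) (Fin 2) ℝ} (h : ∀ t i j, F t i j = (A i j).eval t) :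
    MatGrowth F := fun i j => by
  simp only [h]
  exact ExpGrowth.polynomial _

/-- The product rule for `exp (-t²) 𝔭(t)⁻ᵏ q(t)`. -/
lemma hasDerivAt_gauss (ha : 2 < a ^ 2) (k : ℕ) {q : ℝ → ℝ} {q' t : ℝ} (hq : HasDerivAt q q' t) :
    HasDerivAt (fun s => Real.exp (-s ^ 2) / pfun a s ^ k * q s)
      (Real.exp (-t ^ 2) / pfun a t ^ (k + 1) *
        (pfun a t * (q' - 2 * t * q t) - k * (4 * (2 - a ^ 2) * t) * q t)) t := by
  have hp := pfun_ne_zero ha t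
  have he : HasDerivAt (fun s : ℝ => Real.exp (-s ^ 2)) (Real.exp (-t ^ 2) * (-(2 * t))) t := by
    convert ((hasDerivAt_pow 2 t).fun_neg).exp using 1
    norm_num
  have h := (he.fun_div ((hasDerivAt_pfun a t).fun_pow k) (pow_ne_zero k hp)).fun_mul hq
  refine h.congr_deriv ?_
  rcases k with _ | k
  · simp
    field_simp
    ring
  · simp only [Nat.add_sub_cancel]
    field_simp
    ring

lemma gaussGrowth_Wa (ha : 2 < a ^ 2) : GaussGrowth (Wa a) := by
  refine ⟨fun t => (1 / pfun a t ^ 2) •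
    !![a ^ 2 / (4 * (a ^ 2 - 2)) * pfun a t ^ 2 + pfun a t / (a ^ 2 - 2) - a ^ 2,
        a * (pfun a t / (a ^ 2 - 2) - 2) * t;
       a * (pfun a t / (a ^ 2 - 2) - 2) * t,
        2 * (a ^ 2 * (a ^ 2 - 2) - pfun a t) / (a ^ 2 - 2) ^ 2], ?_, fun t => ?_⟩
  · refine MatGrowth.smul ((ExpGrowth.const 1).div_pfun_pow ha 2) ?_
    have hp := ExpGrowth.pfun a
    have hpb : ExpGrowth fun t => pfun a t / (a ^ 2 - 2) := by
      simpa only [div_eq_mul_inv] using hp.mul (.const _)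
    intro i j
    fin_cases i <;> fin_cases j
    · exact (((ExpGrowth.const _).mul (hp.pow 2)).add hpb).sub (.const _)
    · exact ((ExpGrowth.const _).mul (hpb.sub (.const _))).mul .id
    · exact ((ExpGrowth.const _).mul (hpb.sub (.const _))).mul .id
    · simpa [div_eq_mul_inv] using
        ((ExpGrowth.const 2).mul ((ExpGrowth.const (a ^ 2 * (a ^ 2 - 2))).sub hp)).mul
          (.const ((a ^ 2 - 2) ^ 2)⁻¹)
  · rw [Wa, smul_smul, mul_one_div]

lemma Wa_transpose (a t : ℝ) : (Wa a t).transpose = Wa a t := by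
  ext i j
  fin_cases i <;> fin_cases j <;> simp [Wa]

lemma matrix_two_ext {α : Type*} {A B : Matrix (Fin 2) (Fin 2) α} (h₀₀ : A 0 0 = B 0 0)
    (h₀₁ : A 0 1 = B 0 1) (h₁₀ : A 1 0 = B 1 0) (h₁₁ : A 1 1 = B 1 1) : A = B := by
  ext i j
  fin_cases i <;> fin_cases j <;> assumption

lemma hasMatDeriv_two {F F' : ℝ → Matrix (Fin 2) (Fin 2) ℝ}
    (h₀₀ : ∀ t, HasDerivAt (fun s => F s 0 0) (F' t 0 0) t)
    (h₀₁ : ∀ t, HasDerivAt (fun s => F s 0 1) (F' t 0 1) t)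
    (h₁₀ : ∀ t, HasDerivAt (fun s => F s 1 0) (F' t 1 0) t)
    (h₁₁ : ∀ t, HasDerivAt (fun s => F s 1 1) (F' t 1 1) t) : HasMatDeriv F F' := by
  intro t i j
  fin_cases i <;> fin_cases j
  exacts [h₀₀ t, h₀₁ t, h₁₀ t, h₁₁ t]

/-- The symmetric matrix function `𝓕₂ 𝒲ₐ`. -/
noncomputable def symS (a t : ℝ) : Matrix (Fin 2) (Fin 2) ℝ :=
  (Real.exp (-t ^ 2) / pfun a t ^ 2) •
    !![a ^ 2 * (a ^ 2 - 2) / 4 * (2 * t ^ 2 + 1) ^ 2, -a * t * (2 * t ^ 2 + 1);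
       -a * t * (2 * t ^ 2 + 1), 4 * t ^ 2 / (a ^ 2 - 2)]

/-- The skew-symmetric matrix function `𝓕₁ 𝒲ₐ - (𝓕₂ 𝒲ₐ)'`. -/
noncomputable def skewY (a t : ℝ) : Matrix (Fin 2) (Fin 2) ℝ :=
  (Real.exp (-t ^ 2) / pfun a t ^ 1) • !![0, -1 / a; 1 / a, 0]

lemma F2_mul_Wa (ha : 2 < a ^ 2) (t : ℝ) : (Da a).F2 t * Wa a t = symS a t := by
  have hp := pfun_ne_zero ha t
  have hb : a ^ 2 - 2 ≠ 0 := by linarith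
  have h0 : pfun a t = 2 * (2 - a ^ 2) * t ^ 2 - a ^ 2 := rfl
  apply matrix_two_ext <;> simp only [Da, Wa, symS, Matrix.mul_apply, Fin.sum_univ_two,
    Matrix.smul_apply, smul_eq_mul, Matrix.of_apply, Matrix.cons_val', Matrix.cons_val_zero,
    Matrix.cons_val_one, Matrix.cons_val_fin_one] <;>
    field_simp <;> rw [h0] <;> ring

lemma symS_transpose (a t : ℝ) : (symS a t).transpose = symS a t := by
  ext i j
  fin_cases i <;> fin_cases j <;> simp [symS]

lemma Wa_mul_F2 (ha : 2 < a ^ 2) (t : ℝ) : Wa a t * ((Da a).F2 t).transpose = symS a t := by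
  rw [← symS_transpose, ← F2_mul_Wa ha, Matrix.transpose_mul, Wa_transpose]

/-- The symmetry equation of first order, `2 (𝓕₂ 𝒲ₐ)' = 𝓕₁ 𝒲ₐ + 𝒲ₐ 𝓕₁ᵀ`, written in terms of
`skewY`. -/
lemma two_smul_skewY (ha : 2 < a ^ 2) (t : ℝ) :
    (2 : ℝ) • skewY a t = (Da a).F1 t * Wa a t - Wa a t * ((Da a).F1 t).transpose := by
  have hp := pfun_ne_zero ha t
  have hb : a ^ 2 - 2 ≠ 0 := by linarith
  have h00 : a ≠ 0 := by rintro rfl; norm_num at ha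
  have h0 : pfun a t = 2 * (2 - a ^ 2) * t ^ 2 - a ^ 2 := rfl
  apply matrix_two_ext <;> simp only [Da, Wa, skewY, Matrix.mul_apply, Fin.sum_univ_two,
    Matrix.transpose_apply, Matrix.smul_apply, Matrix.sub_apply, smul_eq_mul, Matrix.of_apply,
    Matrix.cons_val', Matrix.cons_val_zero, Matrix.cons_val_one, Matrix.cons_val_fin_one] <;>
    field_simp <;> try rw [h0]
  all_goals ring

lemma hasMatDeriv_symS (ha : 2 < a ^ 2) :
    HasMatDeriv (symS a) fun t => (Da a).F1 t * Wa a t - skewY a t := by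
  have hb : a ^ 2 - 2 ≠ 0 := by linarith
  have h00 : a ≠ 0 := by rintro rfl; norm_num at ha
  have h2 (t : ℝ) :
      HasDerivAt (fun s : ℝ => -a * s * (2 * s ^ 2 + 1)) (-a * (6 * t ^ 2 + 1)) t := by
    refine (((hasDerivAt_id t).const_mul (-a)).fun_mul
      (((hasDerivAt_pow 2 t).const_mul 2).add_const 1)).congr_deriv ?_
    norm_num
    ring
  have h1 (t : ℝ) : HasDerivAt (fun s : ℝ => a ^ 2 * (a ^ 2 - 2) / 4 * (2 * s ^ 2 + 1) ^ 2)
      (a ^ 2 * (a ^ 2 - 2) * 2 * t * (2 * t ^ 2 + 1)) t := by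
    refine (((((hasDerivAt_pow 2 t).const_mul 2).add_const 1).fun_pow 2).const_mul
      (a ^ 2 * (a ^ 2 - 2) / 4)).congr_deriv ?_
    norm_num
    ring
  have h3 (t : ℝ) : HasDerivAt (fun s : ℝ => 4 * s ^ 2 / (a ^ 2 - 2)) (8 * t / (a ^ 2 - 2)) t := by
    refine (((hasDerivAt_pow 2 t).const_mul 4).div_const (a ^ 2 - 2)).congr_deriv ?_
    norm_num
    ring
  apply hasMatDeriv_two <;> intro t
  on_goal 1 => refine (hasDerivAt_gauss ha 2 (h1 t)).congr_deriv ?_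
  on_goal 2 => refine (hasDerivAt_gauss ha 2 (h2 t)).congr_deriv ?_
  on_goal 3 => refine (hasDerivAt_gauss ha 2 (h2 t)).congr_deriv ?_
  on_goal 4 => refine (hasDerivAt_gauss ha 2 (h3 t)).congr_deriv ?_
  all_goals
    have hp := pfun_ne_zero ha t
    have h0 : pfun a t = 2 * (2 - a ^ 2) * t ^ 2 - a ^ 2 := rfl
    simp only [Da, Wa, skewY, Matrix.mul_apply, Fin.sum_univ_two, Matrix.smul_apply,
      Matrix.sub_apply, smul_eq_mul, Matrix.of_apply, Matrix.cons_val', Matrix.cons_val_zero,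
      Matrix.cons_val_one, Matrix.cons_val_fin_one]
    field_simp
    rw [h0]
    ring

/-- The symmetry equation of order zero. -/
lemma hasMatDeriv_skewY (ha : 2 < a ^ 2) :
    HasMatDeriv (skewY a) fun t => (Da a).F0 t * Wa a t - Wa a t * ((Da a).F0 t).transpose := by
  have hb : a ^ 2 - 2 ≠ 0 := by linarith
  have h00 : a ≠ 0 := by rintro rfl; norm_num at ha
  apply hasMatDeriv_two <;> intro t <;>
    refine (hasDerivAt_gauss ha 1 (hasDerivAt_const t _)).congr_deriv ?_ <;>
    have hp := pfun_ne_zero ha t <;>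
    have h0 : pfun a t = 2 * (2 - a ^ 2) * t ^ 2 - a ^ 2 := rfl <;>
    simp only [Da, Wa, Matrix.mul_apply, Fin.sum_univ_two, Matrix.transpose_apply,
      Matrix.smul_apply, Matrix.sub_apply, smul_eq_mul, Matrix.of_apply, Matrix.cons_val',
      Matrix.cons_val_zero, Matrix.cons_val_one, Matrix.cons_val_fin_one] <;>
    field_simp <;> try rw [h0]
  all_goals ring

end Weight

/-! ### The inner product with a mass at the origin -/

section Inner

variable {a ζ : ℝ}

/-- Integration against `dt + ζ δ₀` of a function that equals `π^{-1/2} g` off the origin. -/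
lemma integral_base (hζ : 0 ≤ ζ) {f g : ℝ → ℝ} (hg : Integrable g)
    (h : ∀ t, t ≠ 0 → f t = 1 / Real.sqrt Real.pi * g t) :
    Integrable f (Waζ a ζ).base ∧
      ∫ t, f t ∂(Waζ a ζ).base = 1 / Real.sqrt Real.pi * (∫ t, g t) + ζ * f 0 := by
  have hae : f =ᵐ[volume] fun t => 1 / Real.sqrt Real.pi * g t := by
    filter_upwards [compl_mem_ae_iff.2 (measure_singleton (0 : ℝ))] with t ht using h t ht
  have h1 : Integrable f volume := (hg.const_mul _).congr hae.symm
  have h2 : Integrable f (ENNReal.ofReal ζ • Measure.dirac 0) :=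
    (integrable_dirac (by simp)).smul_measure ENNReal.ofReal_ne_top
  refine ⟨h1.add_measure h2, ?_⟩
  simp only [Waζ]
  rw [integral_add_measure h1 h2, integral_congr_ae hae, integral_const_mul,
    integral_smul_measure, integral_dirac, ENNReal.toReal_ofReal hζ, smul_eq_mul]

lemma density_of_ne {t : ℝ} (ht : t ≠ 0) :
    (Waζ a ζ).density t = (1 / Real.sqrt Real.pi) • Wa a t :=
  if_neg ht

lemma density_zero : (Waζ a ζ).density 0 = Mmat :=
  if_pos rfl

lemma density_transpose (t : ℝ) :
    ((Waζ a ζ).density t).transpose = (Waζ a ζ).density t := by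
  by_cases ht : t = 0
  · rw [ht, density_zero]
    apply matrix_two_ext <;> rfl
  · rw [density_of_ne ht, Matrix.transpose_smul, Wa_transpose]

lemma integrable_Wa (ha : 2 < a ^ 2) (i j : Fin 2) : Integrable fun t => Wa a t i j :=
  (gaussGrowth_Wa ha).integrable i j

lemma mass_Waζ (ha : 2 < a ^ 2) (hζ : 0 ≤ ζ) {Ω : Set ℝ} (hΩ : MeasurableSet Ω) :
    (Waζ a ζ).mass Ω =
      (1 / Real.sqrt Real.pi) • Matrix.of (fun i j : Fin 2 => ∫ t in Ω, Wa a t i j) +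
        ζ • Set.indicator Ω (fun _ => Mmat) 0 := by
  ext i j
  have h := (integral_base (a := a) hζ ((integrable_Wa ha i j).indicator hΩ)
    (f := Ω.indicator fun t => (Waζ a ζ).density t i j) fun t ht => by
      by_cases hm : t ∈ Ω
      · rw [Set.indicator_of_mem hm, Set.indicator_of_mem hm, density_of_ne ht, Matrix.smul_apply,
          smul_eq_mul]
      · rw [Set.indicator_of_notMem hm, Set.indicator_of_notMem hm, mul_zero]).2
  rw [integral_indicator hΩ, integral_indicator hΩ] at h
  rw [MatrixMeasure.mass, Matrix.of_apply, h]
  simp only [Matrix.add_apply, Matrix.smul_apply, Matrix.of_apply, smul_eq_mul]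
  congr 2
  by_cases hm : (0 : ℝ) ∈ Ω
  · rw [Set.indicator_of_mem hm, Set.indicator_of_mem hm, density_zero]
  · rw [Set.indicator_of_notMem hm, Set.indicator_of_notMem hm, Matrix.zero_apply]

/-- The absolutely continuous part `∫ F(t) 𝒲ₐ(t) G(t)ᵀ dt` of the inner product. -/
noncomputable def innerWa (a : ℝ) (F G : ℝ → Matrix (Fin 2) (Fin 2) ℝ) :
    Matrix (Fin 2) (Fin 2) ℝ :=
  Matrix.of fun i j => ∫ t, (F t * Wa a t * (G t).transpose) i j

variable {F G : ℝ → Matrix (Fin 2) (Fin 2) ℝ}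

lemma gaussGrowth_inner (ha : 2 < a ^ 2) (hF : MatGrowth F) (hG : MatGrowth G) :
    GaussGrowth fun t => F t * Wa a t * (G t).transpose :=
  (hF.mul_gauss (gaussGrowth_Wa ha)).mul hG.transpose

lemma integral_inner (ha : 2 < a ^ 2) (hζ : 0 ≤ ζ) (hF : MatGrowth F) (hG : MatGrowth G)
    (i j : Fin 2) :
    Integrable (fun t => (F t * (Waζ a ζ).density t * (G t).transpose) i j) (Waζ a ζ).base ∧
      (Waζ a ζ).inner F G i j = ((1 / Real.sqrt Real.pi) • innerWa a F G +
        ζ • (F 0 * Mmat * (G 0).transpose)) i j := by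
  have h := integral_base (a := a) hζ ((gaussGrowth_inner ha hF hG).integrable i j)
    (f := fun t => (F t * (Waζ a ζ).density t * (G t).transpose) i j) fun t ht => by
      rw [density_of_ne ht, Matrix.mul_smul, Matrix.smul_mul, Matrix.smul_apply, smul_eq_mul]
  refine ⟨h.1, ?_⟩
  rw [MatrixMeasure.inner, Matrix.of_apply, h.2, density_zero]
  rfl

lemma inner_Waζ (ha : 2 < a ^ 2) (hζ : 0 ≤ ζ) (hF : MatGrowth F) (hG : MatGrowth G) :
    (Waζ a ζ).inner F G = (1 / Real.sqrt Real.pi) • innerWa a F G +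
      ζ • (F 0 * Mmat * (G 0).transpose) := by
  ext i j
  exact (integral_inner ha hζ hF hG i j).2

lemma gaussGrowth_symS (ha : 2 < a ^ 2) : GaussGrowth (symS a) := by
  refine ⟨fun t => (1 / pfun a t ^ 2) •
    !![a ^ 2 * (a ^ 2 - 2) / 4 * (2 * t ^ 2 + 1) ^ 2, -a * t * (2 * t ^ 2 + 1);
       -a * t * (2 * t ^ 2 + 1), 4 * t ^ 2 / (a ^ 2 - 2)], ?_, fun t => ?_⟩
  · refine MatGrowth.smul ((ExpGrowth.const 1).div_pfun_pow ha 2) (MatGrowth.of_polynomial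
      !![C (a ^ 2 * (a ^ 2 - 2) / 4) * (2 * X ^ 2 + 1) ^ 2, -C a * X * (2 * X ^ 2 + 1);
        -C a * X * (2 * X ^ 2 + 1), C (4 / (a ^ 2 - 2)) * X ^ 2] fun t i j => ?_)
    fin_cases i <;> fin_cases j <;> simp
    ring
  · rw [symS, smul_smul, mul_one_div]

lemma gaussGrowth_skewY (ha : 2 < a ^ 2) : GaussGrowth (skewY a) :=
  ⟨_, MatGrowth.smul ((ExpGrowth.const 1).div_pfun_pow ha 1) (MatGrowth.const _), fun t => by
    rw [skewY, smul_smul, mul_one_div]⟩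

/-- The polynomial whose values are `𝔭(t)`. -/
noncomputable def pPoly (a : ℝ) : ℝ[X] :=
  C (2 * (2 - a ^ 2)) * X ^ 2 - C (a ^ 2)

lemma eval_pPoly (a t : ℝ) : (pPoly a).eval t = pfun a t := by
  simp [pPoly, pfun]

lemma exists_F2_eq (a : ℝ) :
    ∃ R : MatPoly 2, ∀ t, (Da a).F2 t = (pfun a t)⁻¹ • value R t := by
  refine ⟨ofEntries
    !![-C (a ^ 2) * (2 * X ^ 2 + 1), -C ((a ^ 2 - 2) * a) * X * (2 * X ^ 2 + 1);
       C (4 * a / (a ^ 2 - 2)) * X, 4 * X ^ 2], fun t => ?_⟩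
  rw [← one_div]
  refine congrArg (fun M => (1 / pfun a t) • M) (matrix_two_ext ?_ ?_ ?_ ?_) <;>
    simp [value_ofEntries] <;> ring

lemma exists_F1_eq (a : ℝ) :
    ∃ R : MatPoly 2, ∀ t, (Da a).F1 t = (pfun a t ^ 2)⁻¹ • value R t := by
  refine ⟨ofEntries
    !![-2 * X * (pPoly a ^ 2 + 4 * pPoly a - C (4 * a ^ 2)),
        C (4 * (a ^ 2 - 2) / a) * X ^ 2 * (-pPoly a + C (2 * a ^ 2));
      C (4 / (a * (a ^ 2 - 2))) * (pPoly a + C (2 * a ^ 2)) * (pPoly a - C (a ^ 2)),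
        -C (8 * a ^ 2) * X], fun t => ?_⟩
  rw [← one_div]
  refine congrArg (fun M => (1 / pfun a t ^ 2) • M) (matrix_two_ext ?_ ?_ ?_ ?_) <;>
    simp only [value_ofEntries, Matrix.of_apply, Matrix.cons_val', Matrix.cons_val_zero,
      Matrix.cons_val_one, Matrix.cons_val_fin_one, eval_mul, eval_add, eval_sub, eval_neg,
      eval_pow, eval_X, eval_C, eval_pPoly, eval_ofNat] <;> ring

lemma isRegularRational_F2 (ha : 2 < a ^ 2) : IsRegularRational (Da a).F2 := by
  obtain ⟨R, hR⟩ := exists_F2_eq a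
  exact ⟨pPoly a, R, fun t => by rw [eval_pPoly]; exact ⟨pfun_ne_zero ha t, hR t⟩⟩

lemma isRegularRational_F1 (ha : 2 < a ^ 2) : IsRegularRational (Da a).F1 := by
  obtain ⟨R, hR⟩ := exists_F1_eq a
  exact ⟨pPoly a ^ 2, R, fun t => by
    rw [eval_pow, eval_pPoly]; exact ⟨pow_ne_zero 2 (pfun_ne_zero ha t), hR t⟩⟩

lemma isRegularRational_F0 (a : ℝ) : IsRegularRational (Da a).F0 :=
  ⟨1, C ((Da a).F0 0), fun t => by
    rw [eval_one, value_C, inv_one, one_smul]; exact ⟨one_ne_zero, rfl⟩⟩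

lemma matGrowth_F2 (ha : 2 < a ^ 2) : MatGrowth (Da a).F2 := by
  obtain ⟨R, hR⟩ := exists_F2_eq a
  rw [funext hR]
  exact MatGrowth.smul (ExpGrowth.inv_pfun ha) (.value R)

lemma matGrowth_F1 (ha : 2 < a ^ 2) : MatGrowth (Da a).F1 := by
  obtain ⟨R, hR⟩ := exists_F1_eq a
  rw [funext hR]
  refine MatGrowth.smul ?_ (.value R)
  simpa only [inv_pow] using (ExpGrowth.inv_pfun ha).pow 2

lemma matGrowth_app (ha : 2 < a ^ 2) (P : MatPoly 2) : MatGrowth ((Da a).app P) :=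
  (((MatGrowth.value _).mul (matGrowth_F2 ha)).add
    ((MatGrowth.value _).mul (matGrowth_F1 ha))).add
    ((MatGrowth.value _).mul (MatGrowth.const _))

/-- The mass at the origin is annihilated by the coefficients of `𝒟`. -/
lemma app_zero_mul_Mmat (ha : 2 < a ^ 2) (P : MatPoly 2) : (Da a).app P 0 * Mmat = 0 := by
  have h00 : a ≠ 0 := by rintro rfl; norm_num at ha
  have h2 : (Da a).F2 0 * Mmat = 0 := by
    apply matrix_two_ext <;> simp [Da, Mmat, Matrix.mul_apply]
  have h1 : (Da a).F1 0 * Mmat = 0 := by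
    apply matrix_two_ext <;> simp [Da, Mmat, Matrix.mul_apply]
  have h0 : (Da a).F0 0 * Mmat = 0 := by
    apply matrix_two_ext <;> simp [Da, Mmat, Matrix.mul_apply]
  rw [DiffOp.app, add_mul, add_mul, mul_assoc, mul_assoc, mul_assoc, h2, h1, h0]
  simp

/-- The algebra behind Green's formula. The index of `P` and `Q` is the order of differentiation,
`Gᵢ` and `Qᵢ` stand for transposes, and `S'`, `Y'` are replaced by the right-hand sides of the
symmetry equations. The right-hand side is the derivative of `P' S Qᵀ - P S Q'ᵀ + P Y Qᵀ`. -/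
lemma green_identity {R : Type*} [Ring R] {P₀ P₁ P₂ Q₀ Q₁ Q₂ F₀ F₁ F₂ G₀ G₁ G₂ W S Y : R}
    (h : F₂ * W = S) (h' : W * G₂ = S) (hY : Y + Y = F₁ * W - W * G₁) :
    (P₂ * F₂ + P₁ * F₁ + P₀ * F₀) * W * Q₀ - P₀ * W * (G₂ * Q₂ + G₁ * Q₁ + G₀ * Q₀) =
      ((P₂ * S + P₁ * (F₁ * W - Y)) * Q₀ + P₁ * S * Q₁) -
        ((P₁ * S + P₀ * (F₁ * W - Y)) * Q₁ + P₀ * S * Q₂) +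
        ((P₁ * Y + P₀ * (F₀ * W - W * G₀)) * Q₀ + P₀ * Y * Q₁) := by
  linear_combination (norm := noncomm_ring) P₂ * h * Q₀ - P₀ * h' * Q₂ - P₀ * hY * Q₁

/-- Green's formula for `𝒟`: the difference of the two integrands is the derivative of
`P' S Qᵀ - P S Q'ᵀ + P Y Qᵀ`, where `S = 𝓕₂ 𝒲ₐ` and `Y = 𝓕₁ 𝒲ₐ - S'`. -/
lemma innerWa_app (ha : 2 < a ^ 2) (P Q : MatPoly 2) :
    innerWa a ((Da a).app P) (value Q) = innerWa a (value P) ((Da a).app Q) := by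
  have hS := hasMatDeriv_symS ha
  have hY := hasMatDeriv_skewY ha
  have hP := hasMatDeriv_value P
  have hP' := hasMatDeriv_value (derivative P)
  have hQ := (hasMatDeriv_value Q).transpose
  have hQ' := (hasMatDeriv_value (derivative Q)).transpose
  have hB := (((hP'.mul hS).mul hQ).sub ((hP.mul hS).mul hQ')).add ((hP.mul hY).mul hQ)
  have gP := MatGrowth.value P
  have gP' := MatGrowth.value (derivative P)
  have gQ := (MatGrowth.value Q).transpose
  have gQ' := (MatGrowth.value (derivative Q)).transpose
  have gS := gaussGrowth_symS ha
  have gY := gaussGrowth_skewY ha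
  have gB := (((gP'.mul_gauss gS).mul gQ).sub ((gP.mul_gauss gS).mul gQ')).add
    ((gP.mul_gauss gY).mul gQ)
  have g1 := gaussGrowth_inner ha (matGrowth_app ha P) (MatGrowth.value Q)
  have g2 := gaussGrowth_inner ha (MatGrowth.value P) (matGrowth_app ha Q)
  have key := GaussGrowth.integral_deriv_eq_zero (F' := fun t =>
      (Da a).app P t * Wa a t * (value Q t).transpose -
        value P t * Wa a t * ((Da a).app Q t).transpose) gB (g1.sub g2) (by
    intro t i j
    refine (hB t i j).congr_deriv (congrFun (congrFun ?_ i) j)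
    have hYY : skewY a t + skewY a t =
        (Da a).F1 t * Wa a t - Wa a t * ((Da a).F1 t).transpose := by
      rw [← two_smul_skewY ha, two_smul]
    simp only [DiffOp.app, Matrix.transpose_add, Matrix.transpose_mul]
    exact (green_identity (F2_mul_Wa ha t) (Wa_mul_F2 ha t) hYY).symm)
  ext i j
  simp only [innerWa, Matrix.of_apply]
  rw [← sub_eq_zero, ← integral_sub (g1.integrable i j) (g2.integrable i j)]
  exact key i j

/-- Symmetry of `𝒟` with respect to `𝒲_{a,ζ}`, for all matrix polynomials. -/
theorem inner_app (ha : 2 < a ^ 2) (hζ : 0 ≤ ζ) (P Q : MatPoly 2) :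
    (Waζ a ζ).inner ((Da a).app P) (value Q) = (Waζ a ζ).inner (value P) ((Da a).app Q) := by
  have hM : Mmat * ((Da a).app Q 0).transpose = 0 := by
    have h : Mmat.transpose = Mmat := by apply matrix_two_ext <;> rfl
    rw [← h, ← Matrix.transpose_mul, app_zero_mul_Mmat ha, Matrix.transpose_zero]
  rw [inner_Waζ ha hζ (matGrowth_app ha P) (.value Q), inner_Waζ ha hζ (.value P)
    (matGrowth_app ha Q), innerWa_app ha, app_zero_mul_Mmat ha, mul_assoc _ Mmat, hM, zero_mul,
    mul_zero]

end Inner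

/-! ### The exceptional space -/

section Space

/-- Degree reduction. In a left submodule in which the degrees from `X` do not occur, a family with
one element of every other degree and with invertible leading coefficients is a graded basis. -/
lemma mem_span_of_degree_lt {R : Type*} [Ring R] {X : Set ℕ} {A : Submodule R R[X]}
    (hA : ∀ Q ∈ A, Q ≠ 0 → Q.natDegree ∉ X) {P : ℕ → R[X]}
    (hP : ∀ k ∉ X, P k ∈ A ∧ (P k).natDegree = k ∧ IsUnit (P k).leadingCoeff) (n : ℕ) :
    ∀ Q ∈ A, Q.degree < n → Q ∈ Submodule.span R (P '' {k | k < n ∧ k ∉ X}) := by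
  induction n with
  | zero =>
    intro Q _ hd
    have : Q = 0 := by
      rw [← Polynomial.degree_eq_bot]
      exact Nat.WithBot.lt_zero_iff.1 (by simpa using hd)
    rw [this]
    exact zero_mem _
  | succ n ih =>
    intro Q hQ hd
    have hmono : Submodule.span R (P '' {k | k < n ∧ k ∉ X}) ≤
        Submodule.span R (P '' {k | k < n + 1 ∧ k ∉ X}) :=
      Submodule.span_mono (Set.image_mono fun k hk => ⟨hk.1.trans (Nat.lt_succ_self n), hk.2⟩)
    by_cases hlt : Q.degree < n
    · exact hmono (ih Q hQ hlt)
    have hQ0 : Q ≠ 0 := by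
      rintro rfl
      exact hlt (by rw [degree_zero]; exact WithBot.bot_lt_coe n)
    have hn : Q.natDegree = n := by
      rw [degree_eq_natDegree hQ0] at hd hlt
      norm_cast at hd hlt
      omega
    obtain ⟨hPA, hPn, u, hu⟩ := hP n (hn ▸ hA Q hQ hQ0)
    have hred : Q - (Q.coeff n * ↑u⁻¹) • P n ∈ Submodule.span R (P '' {k | k < n ∧ k ∉ X}) := by
      refine ih _ (A.sub_mem hQ (A.smul_mem _ hPA))
        ((degree_lt_iff_coeff_zero _ _).2 fun m hm => ?_)
      rw [coeff_sub, coeff_smul, smul_eq_mul]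
      rcases hm.eq_or_lt with rfl | hm
      · have : (P n).coeff n = u := by rw [hu, leadingCoeff, hPn]
        rw [this, mul_assoc, Units.inv_mul, mul_one, sub_self]
      · rw [coeff_eq_zero_of_natDegree_lt (p := Q) (by omega),
          coeff_eq_zero_of_natDegree_lt (p := P n) (by omega), mul_zero, sub_zero]
    rw [← sub_add_cancel Q ((Q.coeff n * ↑u⁻¹) • P n)]
    exact add_mem (hmono hred) (Submodule.smul_mem _ _ (Submodule.subset_span
      ⟨n, ⟨Nat.lt_succ_self n, hn ▸ hA Q hQ hQ0⟩, rfl⟩))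

lemma span_eq_of_degree {R : Type*} [Ring R] {X : Set ℕ} {A : Submodule R R[X]}
    (hA : ∀ Q ∈ A, Q ≠ 0 → Q.natDegree ∉ X) {P : ℕ → R[X]}
    (hP : ∀ k ∉ X, P k ∈ A ∧ (P k).natDegree = k ∧ IsUnit (P k).leadingCoeff) :
    Submodule.span R (P '' Xᶜ) = A := by
  refine le_antisymm (Submodule.span_le.2 ?_) fun Q hQ => ?_
  · rintro _ ⟨k, hk, rfl⟩
    exact (hP k hk).1
  · refine Submodule.span_mono (Set.image_mono fun k hk => hk.2)
      (mem_span_of_degree_lt hA hP (Q.natDegree + 1) Q hQ ?_)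
    exact degree_le_natDegree.trans_lt (by exact_mod_cast Nat.lt_succ_self _)

lemma natDegree_eq_and_isUnit {R : Type*} [Ring R] [Nontrivial R] {P : R[X]} {n : ℕ}
    (h : ∀ m, n < m → P.coeff m = 0) (hu : IsUnit (P.coeff n)) :
    P.natDegree = n ∧ IsUnit P.leadingCoeff := by
  have hn : P.natDegree = n :=
    natDegree_eq_of_le_of_coeff_ne_zero (natDegree_le_iff_coeff_eq_zero.2 fun m hm => h m hm)
      hu.ne_zero
  exact ⟨hn, by rwa [leadingCoeff, hn]⟩

variable {a : ℝ}

/-- The constant matrix `N` with `(P₁')⁻¹ P₁ = t + N`. -/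
noncomputable def nMat (a : ℝ) : Matrix (Fin 2) (Fin 2) ℝ :=
  !![0, -a / 2; a / (a ^ 2 - 2), 0]

/-- The matrix polynomial `K(t) = t + N`. -/
noncomputable def kPoly (a : ℝ) : MatPoly 2 := X + C (nMat a)

lemma value_kPoly (a t : ℝ) : value (kPoly a) t = !![t, -a / 2; a / (a ^ 2 - 2), t] := by
  rw [kPoly, value_add, value_X, value_C]
  apply matrix_two_ext <;> simp [nMat]

lemma monic_kPoly (a : ℝ) : (kPoly a).Monic := monic_X_add_C _

/-- Evaluation with the matrix argument on the right is multiplicative here, since the coefficients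
of `K` commute with `N`. -/
lemma eval_mul_kPoly (Z : MatPoly 2) : (Z * kPoly a).eval (-nMat a) = 0 := by
  have h : (kPoly a).eval (-nMat a) = 0 := by simp [kPoly]
  rw [eval, eval₂_mul_noncomm, ← eval, ← eval, h, mul_zero]
  intro k
  rw [RingHom.id_apply, kPoly, coeff_add, coeff_X, coeff_C]
  refine Commute.add_left ?_ ?_ <;> split_ifs
  · exact Commute.one_left _
  · exact Commute.zero_left _
  · exact (Commute.refl _).neg_right
  · exact Commute.zero_left _

lemma hermiteH_one : hermiteH 1 = 2 * X := by simp [hermiteH]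

lemma opA_eq (ha : 2 < a ^ 2) (y : MatPoly 2) : opA a y = derivative y * kPoly a - y := by
  have hb : a ^ 2 - 2 ≠ 0 := by linarith
  have hb' : 2 - a ^ 2 ≠ 0 := by linarith
  have hinv : (!![2, 0; 0, 2 - a ^ 2] : Matrix (Fin 2) (Fin 2) ℝ)⁻¹ =
      !![1 / 2, 0; 0, 1 / (2 - a ^ 2)] := by
    refine Matrix.inv_eq_right_inv (matrix_two_ext ?_ ?_ ?_ ?_) <;> simp [Matrix.mul_apply]
    exact mul_inv_cancel₀ hb'
  have h : C ((!![2, 0; 0, 2 - a ^ 2] : Matrix (Fin 2) (Fin 2) ℝ)⁻¹) * hermitePn a 1 =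
      kPoly a := by
    refine matPoly_ext fun t => ?_
    rw [value_mul, value_C, value_kPoly, hinv, hermitePn, value_ofEntries, hermiteH_one]
    apply matrix_two_ext <;> simp [Matrix.mul_apply, hermiteH]
    · ring
    · rw [← neg_sub (a ^ 2) 2, inv_neg]
      ring
    · field_simp
      ring
  rw [opA, mul_assoc, h]
  abel

lemma derivative_opA (ha : 2 < a ^ 2) (y : MatPoly 2) :
    derivative (opA a y) = derivative (derivative y) * kPoly a := by
  rw [opA_eq ha, derivative_sub, derivative_mul, kPoly, derivative_add, derivative_X, derivative_C,
    add_zero, mul_one, add_sub_cancel_right]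

/-- The matrix polynomials `P` with `P'(-N) = 0`, where the matrix argument is substituted to the
right of the coefficients. It is the image of the operator `𝒜`. -/
noncomputable def excSpace (a : ℝ) : Submodule (Matrix (Fin 2) (Fin 2) ℝ) (MatPoly 2) :=
  LinearMap.ker ((leval (-nMat a)).comp derivative)

lemma mem_excSpace {P : MatPoly 2} : P ∈ excSpace a ↔ (derivative P).eval (-nMat a) = 0 :=
  Iff.rfl

lemma opA_mem_excSpace (ha : 2 < a ^ 2) (y : MatPoly 2) : opA a y ∈ excSpace a := by
  rw [mem_excSpace, derivative_opA ha, eval_mul_kPoly]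

lemma kPoly_pow_mem (n : ℕ) (hn : n ≠ 1) : kPoly a ^ n ∈ excSpace a := by
  have hd : derivative (kPoly a) = 1 := by simp [kPoly]
  have h (m : ℕ) : derivative (kPoly a ^ m) = m * kPoly a ^ (m - 1) := by
    induction m with
    | zero => simp
    | succ m ih =>
      rw [pow_succ, derivative_mul, ih, hd, mul_one, Nat.add_sub_cancel]
      rcases m with _ | m
      · simp
      · rw [Nat.add_sub_cancel, mul_assoc, ← pow_succ]
        rw [Nat.cast_succ (m + 1), add_mul _ 1, one_mul]
  rw [mem_excSpace, h]
  rcases n with _ | _ | n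
  · simp
  · exact absurd rfl hn
  · rw [show n + 1 + 1 - 1 = n + 1 from rfl, pow_succ, ← mul_assoc, eval_mul_kPoly]

/-- There is no element of degree one, since the derivative of a polynomial of degree one is a
nonzero constant. -/
lemma natDegree_notMem_of_mem_excSpace {P : MatPoly 2} (hP : P ∈ excSpace a) (_ : P ≠ 0) :
    P.natDegree ∉ ({1} : Set ℕ) := by
  intro h1
  rw [Set.mem_singleton_iff] at h1
  obtain ⟨c, hc, d, rfl⟩ := natDegree_eq_one.1 h1
  rw [mem_excSpace] at hP
  simp at hP
  exact hc hP

lemma coeff_opA (ha : 2 < a ^ 2) (y : MatPoly 2) (m : ℕ) :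
    (opA a y).coeff m =
      ((m : ℝ) - 1) • y.coeff m + ((m : ℝ) + 1) • (y.coeff (m + 1) * nMat a) := by
  have hc (k : ℕ) : (derivative y).coeff k = ((k : ℝ) + 1) • y.coeff (k + 1) := by
    rw [coeff_derivative, ← Nat.cast_succ, ← Nat.cast_succ, ← nsmul_eq_mul', Nat.cast_smul_eq_nsmul]
  rw [opA_eq ha, coeff_sub, kPoly, mul_add, coeff_add, coeff_mul_C, hc, smul_mul_assoc]
  rcases m with _ | m
  · simp
    abel
  · rw [coeff_mul_X, hc]
    push_cast
    rw [sub_smul _ (1 : ℝ), one_smul]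
    abel

lemma natDegree_opA_le (ha : 2 < a ^ 2) (y : MatPoly 2) :
    (opA a y).natDegree ≤ y.natDegree := by
  refine natDegree_le_iff_coeff_eq_zero.2 fun m hm => ?_
  rw [coeff_opA ha, coeff_eq_zero_of_natDegree_lt hm,
    coeff_eq_zero_of_natDegree_lt (hm.trans (Nat.lt_succ_self m))]
  simp

/-! ### Hermite polynomials -/

lemma coeff_hermiteH (n : ℕ) :
    (hermiteH n).coeff n = 2 ^ n ∧ ∀ m, n < m → (hermiteH n).coeff m = 0 := by
  induction n with
  | zero =>
    refine ⟨by simp [hermiteH], fun m hm => ?_⟩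
    rw [hermiteH, coeff_one, if_neg hm.ne']
  | succ n ih =>
    have h (m : ℕ) : (hermiteH (n + 1)).coeff (m + 1) =
        2 * (hermiteH n).coeff m - (hermiteH n).coeff (m + 1 + 1) * ((m + 1 : ℕ) + 1) := by
      rw [hermiteH, coeff_sub, coeff_derivative, mul_comm 2 X, mul_assoc, coeff_X_mul,
        ← C_ofNat, coeff_C_mul]
    refine ⟨?_, fun m hm => ?_⟩
    · rw [h, ih.1, ih.2 _ (by omega)]
      ring
    · obtain ⟨m, rfl⟩ : ∃ k, m = k + 1 := ⟨m - 1, by omega⟩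
      rw [h, ih.2 _ (by omega), ih.2 _ (by omega)]
      ring

lemma coeff_ofEntries (A : Matrix (Fin 2) (Fin 2) ℝ[X]) (k : ℕ) :
    (ofEntries A).coeff k = Matrix.of fun i j => (A i j).coeff k := by
  ext i j
  exact matPolyEquiv_coeff_apply _ _ _ _

lemma coeff_hermitePn (a : ℝ) (n : ℕ) :
    (hermitePn a n).coeff n = !![2 ^ n, 0; 0, 2 ^ n * (1 - a ^ 2 + n * a ^ 2 / 2)] ∧
      ∀ m, n < m → (hermitePn a n).coeff m = 0 := by
  have hn : ((n : ℕ) : ℝ[X]) = C (n : ℝ) := by simp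
  rcases n with _ | n
  · refine ⟨?_, fun m hm => ?_⟩
    · rw [hermitePn, coeff_ofEntries]
      apply matrix_two_ext <;> simp [hermiteH, -map_sub, -map_pow]
    · rw [hermitePn, coeff_ofEntries]
      apply matrix_two_ext <;>
        simp [hermiteH, coeff_one, coeff_C, hm.ne', -map_sub, -map_pow]
  · obtain ⟨h1, h2⟩ := coeff_hermiteH (n + 1)
    obtain ⟨h3, h4⟩ := coeff_hermiteH n
    have e (b : ℝ) : ((n + 1 : ℕ) : ℝ[X]) * C b = C ((n + 1 : ℕ) * b) := by rw [C_mul, ← hn]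
    refine ⟨?_, fun m hm => ?_⟩
    · rw [hermitePn, coeff_ofEntries]
      apply matrix_two_ext <;>
        simp only [Matrix.of_apply, Matrix.cons_val', Matrix.cons_val_zero, Matrix.cons_val_one,
          Matrix.cons_val_fin_one, Nat.add_sub_cancel, neg_mul, coeff_neg, coeff_add, e, mul_assoc,
          coeff_C_mul, coeff_X_mul, h1, h3, h4 (n + 1) (Nat.lt_succ_self n)]
      · ring
      · ring
      · ring
    · obtain ⟨m, rfl⟩ : ∃ k, m = k + 1 := ⟨m - 1, by omega⟩
      rw [hermitePn, coeff_ofEntries]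
      apply matrix_two_ext <;>
        simp only [Matrix.of_apply, Matrix.cons_val', Matrix.cons_val_zero, Matrix.cons_val_one,
          Matrix.cons_val_fin_one, Nat.add_sub_cancel, neg_mul, coeff_neg, coeff_add, e,
          coeff_C_mul, h2 _ hm, h4 (m + 1) (by omega), Matrix.zero_apply]
      · ring
      · ring
      · rw [mul_assoc, coeff_C_mul, coeff_X_mul, h4 m (by omega)]
        ring

/-- The entry `1 - a² + n a² / 2` of the leading coefficient is negative for `n ≤ 1` and positive
for `n ≥ 2`. -/
lemma isUnit_coeff_hermitePn (ha : 2 < a ^ 2) (n : ℕ) : IsUnit ((hermitePn a n).coeff n) := by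
  rw [(coeff_hermitePn a n).1, Matrix.isUnit_iff_isUnit_det, Matrix.det_fin_two_of,
    isUnit_iff_ne_zero, zero_mul, sub_zero]
  refine mul_ne_zero (by positivity) (mul_ne_zero (by positivity) ?_)
  rcases n with _ | _ | n
  · norm_num; linarith
  · norm_num; linarith
  · push_cast
    have : (0 : ℝ) ≤ n := n.cast_nonneg
    nlinarith

lemma excP_basis (ha : 2 < a ^ 2) (n : ℕ) (hn : n ≠ 1) :
    excP a n ∈ excSpace a ∧ (excP a n).natDegree = n ∧ IsUnit (excP a n).leadingCoeff := by
  refine ⟨opA_mem_excSpace ha _, natDegree_eq_and_isUnit (fun m hm => ?_) ?_⟩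
  · have h := (coeff_hermitePn a n).2
    rw [excP, coeff_opA ha, h m hm, h (m + 1) (by omega)]
    simp
  · have hn' : (n : ℝ) - 1 ≠ 0 := sub_ne_zero.2 (by exact_mod_cast hn)
    rw [excP, coeff_opA ha, (coeff_hermitePn a n).2 (n + 1) (by omega), zero_mul, smul_zero,
      add_zero]
    exact (isUnit_coeff_hermitePn ha n).smul (Units.mk0 _ hn')

/-! ### The intertwining relation -/

/-- The second order operator with polynomial coefficients that `𝒜` intertwines with `𝒟`. -/
noncomputable def opE (a : ℝ) (y : MatPoly 2) : MatPoly 2 :=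
  derivative (derivative y) * (C !![0, a; 0, 0] * X + C !![0, 0; 0, 1]) +
    derivative y * (C !![-2, 0; 0, 0] * X + C !![0, 2 / a; -2 / a, 0]) + y * C ((Da a).F0 0)

lemma natDegree_opE_le (y : MatPoly 2) : (opE a y).natDegree ≤ y.natDegree := by
  have hlin (U V : Matrix (Fin 2) (Fin 2) ℝ) : (C U * X + C V).natDegree ≤ 1 :=
    natDegree_linear_le
  rcases Nat.eq_zero_or_pos y.natDegree with h0 | h0
  · obtain ⟨c, rfl⟩ := natDegree_eq_zero.1 h0
    rw [opE, derivative_C, derivative_zero, zero_mul, zero_mul, zero_add, zero_add, ← C_mul,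
      natDegree_C]
    exact Nat.zero_le _
  have h1 := natDegree_derivative_le y
  have h2 := natDegree_derivative_le (derivative y)
  refine natDegree_add_le_of_degree_le (natDegree_add_le_of_degree_le ?_ ?_) ?_
  · exact natDegree_mul_le.trans (by have := hlin !![0, a; 0, 0] !![0, 0; 0, 1]; omega)
  · exact natDegree_mul_le.trans
      (by have := hlin !![-2, 0; 0, 0] !![0, 2 / a; -2 / a, 0]; omega)
  · exact natDegree_mul_C_le _ _

/-- The intertwining relation of `𝒟` and `opE`. Comparison of the terms with the third, second and
first derivative of `y` reduces it to three identities for the coefficients. -/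
lemma app_opA (ha : 2 < a ^ 2) (y : MatPoly 2) (t : ℝ) :
    (Da a).app (opA a y) t = value (opA a (opE a y)) t := by
  have hp := pfun_ne_zero ha t
  have hb : a ^ 2 - 2 ≠ 0 := by linarith
  have h00 : a ≠ 0 := by rintro rfl; norm_num at ha
  have h0 : pfun a t = 2 * (2 - a ^ 2) * t ^ 2 - a ^ 2 := rfl
  set A₂ : Matrix (Fin 2) (Fin 2) ℝ := !![0, a * t; 0, 1] with hA₂
  set A₁ : Matrix (Fin 2) (Fin 2) ℝ := !![-2 * t, 2 / a; -2 / a, 0] with hA₁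
  set F₀ : Matrix (Fin 2) (Fin 2) ℝ := (Da a).F0 0 with hF₀
  set k : Matrix (Fin 2) (Fin 2) ℝ := !![t, -a / 2; a / (a ^ 2 - 2), t] with hk
  have e2 : value (C !![0, a; 0, 0] * X + C !![0, 0; 0, 1]) t = A₂ := by
    rw [value_add, value_mul, value_C, value_C, value_X]
    apply matrix_two_ext <;> simp [hA₂]
    ring
  have e1 : value (C !![-2, 0; 0, 0] * X + C !![0, 2 / a; -2 / a, 0]) t = A₁ := by
    rw [value_add, value_mul, value_C, value_C, value_X]
    apply matrix_two_ext <;> simp [hA₁]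
    ring
  have i1 : k * (Da a).F2 t = A₂ * k := by
    apply matrix_two_ext <;> simp only [Da, hk, hA₂, Matrix.mul_apply, Fin.sum_univ_two,
      Matrix.smul_apply, smul_eq_mul, Matrix.of_apply, Matrix.cons_val',
      Matrix.cons_val_zero, Matrix.cons_val_one, Matrix.cons_val_fin_one] <;>
      field_simp <;> rw [h0] <;> ring
  have i2 : (Da a).F2 t + k * (Da a).F1 t = !![0, a; 0, 0] * k + A₁ * k - A₂ := by
    apply matrix_two_ext <;> simp only [Da, hk, hA₂, hA₁, Matrix.mul_apply, Fin.sum_univ_two,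
      Matrix.add_apply, Matrix.sub_apply, Matrix.smul_apply, smul_eq_mul, Matrix.of_apply,
      Matrix.cons_val', Matrix.cons_val_zero, Matrix.cons_val_one, Matrix.cons_val_fin_one] <;>
      field_simp <;> rw [h0] <;> ring
  have i3 : k * F₀ = !![-2, 0; 0, 0] * k + F₀ * k - A₁ := by
    apply matrix_two_ext <;> simp only [Da, hk, hF₀, hA₁, Matrix.mul_apply, Fin.sum_univ_two,
      Matrix.add_apply, Matrix.sub_apply, Matrix.of_apply, Matrix.cons_val',
      Matrix.cons_val_zero, Matrix.cons_val_one, Matrix.cons_val_fin_one] <;>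
      field_simp <;> ring
  have hk' : value (kPoly a) t = k := value_kPoly a t
  have hd2 : value (derivative (derivative (opA a y))) t =
      value (derivative (derivative (derivative y))) t * k +
        value (derivative (derivative y)) t := by
    rw [derivative_opA ha, derivative_mul, kPoly, derivative_add, derivative_X, derivative_C,
      add_zero, mul_one, ← kPoly, value_add, value_mul, hk']
  have hdE : value (derivative (opE a y)) t =
      value (derivative (derivative (derivative y))) t * A₂ +
      value (derivative (derivative y)) t * !![0, a; 0, 0] +
      (value (derivative (derivative y)) t * A₁ + value (derivative y) t * !![-2, 0; 0, 0]) +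
      value (derivative y) t * F₀ := by
    have hl (U V : Matrix (Fin 2) (Fin 2) ℝ) : derivative (C U * X + C V) = C U := by simp
    rw [opE, derivative_add, derivative_add, derivative_mul, derivative_mul, derivative_mul,
      derivative_C, mul_zero, add_zero, hl, hl]
    simp only [value_add, value_mul, e1, e2, value_C]
    rfl
  have hF0 : (Da a).F0 t = F₀ := rfl
  rw [DiffOp.app, hd2, derivative_opA ha, opA_eq ha (opE a y), opA_eq ha y, value_sub, value_sub,
    value_mul, value_mul, value_mul, hdE, hk', hF0]
  rw [opE, value_add, value_add, value_mul, value_mul, value_mul, e1, e2, value_C, ← hF₀]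
  linear_combination (norm := noncomm_ring) value (derivative (derivative (derivative y))) t * i1 +
    value (derivative (derivative y)) t * i2 + value (derivative y) t * i3

/-- `𝒟` maps the elements of degree below `n` of the exceptional space to elements of the same
kind. -/
lemma exists_app_eq_value (ha : 2 < a ^ 2) (n : ℕ) {P : MatPoly 2} (hP : P ∈ excSpace a)
    (hd : P.degree < n) :
    ∃ Q ∈ excSpace a, Q.degree < n ∧ ∀ t, (Da a).app P t = value Q t := by
  have h := mem_span_of_degree_lt (fun Q hQ h0 => natDegree_notMem_of_mem_excSpace hQ h0)
    (fun k hk => excP_basis ha k hk) n P hP hd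
  clear hP hd
  induction h using Submodule.span_induction with
  | mem P h =>
    obtain ⟨k, ⟨hk, -⟩, rfl⟩ := h
    refine ⟨opA a (opE a (hermitePn a k)), opA_mem_excSpace ha _, ?_, fun t => app_opA ha _ t⟩
    refine degree_le_natDegree.trans_lt ?_
    have h1 := natDegree_opA_le ha (opE a (hermitePn a k))
    have h2 := natDegree_opE_le (a := a) (hermitePn a k)
    have h3 : (hermitePn a k).natDegree ≤ k :=
      natDegree_le_iff_coeff_eq_zero.2 fun m hm => (coeff_hermitePn a k).2 m hm
    exact_mod_cast (h1.trans (h2.trans h3)).trans_lt hk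
  | zero =>
    refine ⟨0, zero_mem _, by rw [degree_zero]; exact WithBot.bot_lt_coe n, fun t => ?_⟩
    simp [DiffOp.app, value_zero]
  | add P P' _ _ h h' =>
    obtain ⟨Q, hQ, hd, h⟩ := h
    obtain ⟨Q', hQ', hd', h'⟩ := h'
    refine ⟨Q + Q', add_mem hQ hQ', (degree_add_le _ _).trans_lt (max_lt hd hd'), fun t => ?_⟩
    rw [value_add, ← h, ← h']
    simp only [DiffOp.app, derivative_add, value_add]
    noncomm_ring
  | smul c P _ h =>
    obtain ⟨Q, hQ, hd, h⟩ := h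
    refine ⟨c • Q, Submodule.smul_mem _ _ hQ, (degree_smul_le _ _).trans_lt hd, fun t => ?_⟩
    rw [value_smul, ← h]
    simp only [DiffOp.app, derivative_smul, value_smul]
    noncomm_ring

end Space

/-! ### Positivity of the weight -/

section Positivity

open scoped Matrix

variable {a ζ : ℝ}

lemma Wa_one_one_pos (ha : 2 < a ^ 2) (t : ℝ) : 0 < Wa a t 1 1 := by
  have hp := pfun_neg ha t
  have hb : 0 < a ^ 2 - 2 := by linarith
  have h : 0 < a ^ 2 * (a ^ 2 - 2) - pfun a t := by nlinarith
  have hp0 := hp.ne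
  simp only [Wa, Matrix.smul_apply, smul_eq_mul, Matrix.of_apply, Matrix.cons_val',
    Matrix.cons_val_one, Matrix.cons_val_fin_one]
  positivity

lemma det_Wa (ha : 2 < a ^ 2) (t : ℝ) :
    (Wa a t).det = Real.exp (-t ^ 2) ^ 2 * (a ^ 2 - 1) / (2 * (a ^ 2 - 2) * pfun a t ^ 2) := by
  have hp := pfun_ne_zero ha t
  have hb : a ^ 2 - 2 ≠ 0 := by linarith
  have h0 : pfun a t = 2 * (2 - a ^ 2) * t ^ 2 - a ^ 2 := rfl
  simp only [Matrix.det_fin_two, Wa, Matrix.smul_apply, smul_eq_mul, Matrix.of_apply,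
    Matrix.cons_val', Matrix.cons_val_zero, Matrix.cons_val_one, Matrix.cons_val_fin_one]
  field_simp
  rw [h0]
  ring

lemma det_Wa_pos (ha : 2 < a ^ 2) (t : ℝ) : 0 < (Wa a t).det := by
  rw [det_Wa ha]
  have hp := pfun_neg ha t
  have hb : 0 < a ^ 2 - 2 := by linarith
  have hp0 := hp.ne
  have h1 : 0 < a ^ 2 - 1 := by linarith
  positivity

lemma quad_two (A : Matrix (Fin 2) (Fin 2) ℝ) (v : Fin 2 → ℝ) :
    v ⬝ᵥ A *ᵥ v =
      v 0 * (A 0 0 * v 0 + A 0 1 * v 1) + v 1 * (A 1 0 * v 0 + A 1 1 * v 1) := by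
  simp [dotProduct, Matrix.mulVec, Fin.sum_univ_two]

lemma Wa_quad_pos (ha : 2 < a ^ 2) (t : ℝ) {v : Fin 2 → ℝ} (hv : v ≠ 0) :
    0 < v ⬝ᵥ Wa a t *ᵥ v := by
  have h11 := Wa_one_one_pos ha t
  have hdet := det_Wa_pos ha t
  have hs : Wa a t 1 0 = Wa a t 0 1 := congrFun (congrFun (Wa_transpose a t) 0) 1
  rw [Matrix.det_fin_two, hs] at hdet
  rw [quad_two, hs]
  by_cases h0 : v 0 = 0
  · have h1 : v 1 ≠ 0 := by
      intro h1
      exact hv (funext fun i => by fin_cases i <;> assumption)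
    rw [h0]
    have : 0 < v 1 ^ 2 := by positivity
    nlinarith [mul_pos h11 this]
  · have : 0 < v 0 ^ 2 := by positivity
    refine pos_of_mul_pos_right (a := Wa a t 1 1) ?_ h11.le
    nlinarith [mul_pos hdet this, sq_nonneg (Wa a t 1 1 * v 1 + Wa a t 0 1 * v 0)]

lemma density_quad_pos (ha : 2 < a ^ 2) {t : ℝ} (ht : t ≠ 0) {v : Fin 2 → ℝ} (hv : v ≠ 0) :
    0 < v ⬝ᵥ (Waζ a ζ).density t *ᵥ v := by
  rw [density_of_ne ht, Matrix.smul_mulVec, dotProduct_smul, smul_eq_mul]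
  have := Wa_quad_pos ha t hv
  positivity

lemma density_quad_nonneg (ha : 2 < a ^ 2) (t : ℝ) (v : Fin 2 → ℝ) :
    0 ≤ v ⬝ᵥ (Waζ a ζ).density t *ᵥ v := by
  by_cases ht : t = 0
  · rw [ht, density_zero, quad_two]
    simp [Mmat, mul_self_nonneg]
  · by_cases hv : v = 0
    · simp [hv]
    · exact (density_quad_pos ha ht hv).le

lemma volume_le_base : volume ≤ (Waζ a ζ).base :=
  Measure.le_add_right le_rfl

lemma integrable_density (ha : 2 < a ^ 2) (hζ : 0 ≤ ζ) (i j : Fin 2) :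
    Integrable (fun t => (Waζ a ζ).density t i j) (Waζ a ζ).base :=
  (integral_base hζ (integrable_Wa ha i j) fun t ht => by
    rw [density_of_ne ht, Matrix.smul_apply, smul_eq_mul]).1

lemma setIntegral_quad_pos (ha : 2 < a ^ 2) {Ω : Set ℝ} (hvol : volume Ω ≠ 0)
    {u : ℝ → Fin 2 → ℝ}
    (hint : IntegrableOn (fun t => u t ⬝ᵥ (Waζ a ζ).density t *ᵥ u t) Ω (Waζ a ζ).base)
    (hu : ∀ᵐ t, u t ≠ 0) : 0 < ∫ t in Ω, u t ⬝ᵥ (Waζ a ζ).density t *ᵥ u t ∂(Waζ a ζ).base := by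
  rw [setIntegral_pos_iff_support_of_nonneg_ae
    (Filter.Eventually.of_forall fun t => density_quad_nonneg ha t _) hint]
  refine lt_of_lt_of_le (pos_iff_ne_zero.2 fun h => hvol ?_) (volume_le_base _)
  have h0 : ∀ᵐ t : ℝ, t ≠ 0 := compl_mem_ae_iff.2 (measure_singleton 0)
  rw [← h]
  refine measure_congr ?_
  filter_upwards [h0, hu] with t ht hut
  refine propext ⟨fun hm => ⟨(density_quad_pos ha ht hut).ne', hm⟩, fun hm => hm.2⟩

lemma quad_integral {μ : Measure ℝ} {m : ℝ → Matrix (Fin 2) (Fin 2) ℝ}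
    (hm : ∀ i j, Integrable (fun t => m t i j) μ) (v : Fin 2 → ℝ) :
    Integrable (fun t => v ⬝ᵥ m t *ᵥ v) μ ∧
      v ⬝ᵥ (Matrix.of fun i j => ∫ t, m t i j ∂μ) *ᵥ v = ∫ t, v ⬝ᵥ m t *ᵥ v ∂μ := by
  have h (i j : Fin 2) : Integrable (fun t => v i * (m t i j * v j)) μ :=
    ((hm i j).mul_const _).const_mul _
  simp only [dotProduct, Matrix.mulVec, Finset.mul_sum, Matrix.of_apply]
  refine ⟨integrable_finsetSum _ fun i _ => integrable_finsetSum _ fun j _ => h i j, ?_⟩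
  rw [integral_finsetSum _ fun i _ => integrable_finsetSum _ fun j _ => h i j]
  refine Finset.sum_congr rfl fun i _ => ?_
  rw [integral_finsetSum _ fun j _ => h i j]
  refine Finset.sum_congr rfl fun j _ => ?_
  rw [integral_const_mul, integral_mul_const]

lemma mass_isHermitian (Ω : Set ℝ) : ((Waζ a ζ).mass Ω).IsHermitian := by
  ext i j
  rw [Matrix.conjTranspose_apply, star_trivial, MatrixMeasure.mass, Matrix.of_apply,
    Matrix.of_apply]
  congr 1
  ext t
  exact congrFun (congrFun (density_transpose t) i) j

lemma mass_quad (ha : 2 < a ^ 2) (hζ : 0 ≤ ζ) (Ω : Set ℝ) (v : Fin 2 → ℝ) :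
    IntegrableOn (fun t => v ⬝ᵥ (Waζ a ζ).density t *ᵥ v) Ω (Waζ a ζ).base ∧
      v ⬝ᵥ (Waζ a ζ).mass Ω *ᵥ v =
        ∫ t in Ω, v ⬝ᵥ (Waζ a ζ).density t *ᵥ v ∂(Waζ a ζ).base :=
  quad_integral (fun i j => (integrable_density ha hζ i j).integrableOn) v

lemma mass_posSemidef (ha : 2 < a ^ 2) (hζ : 0 ≤ ζ) (Ω : Set ℝ) :
    ((Waζ a ζ).mass Ω).PosSemidef := by
  refine .of_dotProduct_mulVec_nonneg (mass_isHermitian Ω) fun v => ?_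
  rw [star_trivial, (mass_quad ha hζ Ω v).2]
  exact integral_nonneg fun t => density_quad_nonneg ha t v

lemma mass_posDef (ha : 2 < a ^ 2) (hζ : 0 ≤ ζ) {Ω : Set ℝ} (hΩ : volume Ω ≠ 0) :
    ((Waζ a ζ).mass Ω).PosDef := by
  refine .of_dotProduct_mulVec_pos (mass_isHermitian Ω) fun v hv => ?_
  rw [star_trivial, (mass_quad ha hζ Ω v).2]
  exact setIntegral_quad_pos ha hΩ (mass_quad ha hζ Ω v).1 (Filter.Eventually.of_forall fun _ => hv)

theorem isWeight_Waζ (ha : 2 < a ^ 2) (hζ : 0 ≤ ζ) : (Waζ a ζ).IsWeight where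
  moments n i j := by
    obtain ⟨G, hG, h⟩ := (gaussGrowth_Wa ha)
    have hint := ((ExpGrowth.id.pow n).mul (hG i j)).integrable_gaussian
    refine (integral_base hζ hint fun t ht => ?_).1
    rw [density_of_ne ht, h, Matrix.smul_apply, Matrix.smul_apply, smul_eq_mul, smul_eq_mul]
    ring
  posSemidef Ω _ := mass_posSemidef ha hζ Ω
  posDef := ⟨Set.univ, MeasurableSet.univ, mass_posDef ha hζ (by simp)⟩
  infinite_supp := by
    have h : (Waζ a ζ).supp = Set.univ := by
      refine Set.eq_univ_of_forall fun x ε hε h0 => ?_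
      have hpos := mass_posDef ha hζ (a := a) (ζ := ζ) (Ω := Set.Ioo (x - ε) (x + ε)) (by
        rw [Real.volume_Ioo, Ne, ENNReal.ofReal_eq_zero]
        linarith)
      rw [h0] at hpos
      exact lt_irrefl _ (hpos.diag_pos (i := 0))
    rw [h]
    exact Set.infinite_univ

/-! ### The inner product on matrix polynomials -/

/-- The matrix valued inner product of two matrix polynomials. -/
noncomputable def polyInner (a ζ : ℝ) (P Q : MatPoly 2) : Matrix (Fin 2) (Fin 2) ℝ :=
  (Waζ a ζ).inner (value P) (value Q)

lemma polyInner_integrable (ha : 2 < a ^ 2) (hζ : 0 ≤ ζ) (P Q : MatPoly 2) (i j : Fin 2) :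
    Integrable (fun t => (value P t * (Waζ a ζ).density t * (value Q t).transpose) i j)
      (Waζ a ζ).base :=
  (integral_inner ha hζ (.value P) (.value Q) i j).1

lemma polyInner_transpose (P Q : MatPoly 2) : (polyInner a ζ P Q)ᵀ = polyInner a ζ Q P := by
  ext i j
  rw [Matrix.transpose_apply, polyInner, polyInner, MatrixMeasure.inner, MatrixMeasure.inner,
    Matrix.of_apply, Matrix.of_apply]
  congr 1
  ext t
  have h : (value P t * (Waζ a ζ).density t * (value Q t)ᵀ)ᵀ =
      value Q t * (Waζ a ζ).density t * (value P t)ᵀ := by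
    rw [Matrix.transpose_mul, Matrix.transpose_mul, Matrix.transpose_transpose, density_transpose,
      mul_assoc]
  exact congrFun (congrFun h i) j

lemma polyInner_sub_left (ha : 2 < a ^ 2) (hζ : 0 ≤ ζ) (P Q R : MatPoly 2) :
    polyInner a ζ (P - Q) R = polyInner a ζ P R - polyInner a ζ Q R := by
  ext i j
  simp only [polyInner, MatrixMeasure.inner, Matrix.of_apply, Matrix.sub_apply]
  rw [← integral_sub (polyInner_integrable ha hζ P R i j) (polyInner_integrable ha hζ Q R i j)]
  simp only [value_sub, Matrix.sub_mul, Matrix.sub_apply]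

lemma polyInner_add_left (ha : 2 < a ^ 2) (hζ : 0 ≤ ζ) (P Q R : MatPoly 2) :
    polyInner a ζ (P + Q) R = polyInner a ζ P R + polyInner a ζ Q R := by
  ext i j
  simp only [polyInner, MatrixMeasure.inner, Matrix.of_apply, Matrix.add_apply]
  rw [← integral_add (polyInner_integrable ha hζ P R i j) (polyInner_integrable ha hζ Q R i j)]
  simp only [value_add, Matrix.add_mul, Matrix.add_apply]

lemma polyInner_zero_left (R : MatPoly 2) : polyInner a ζ 0 R = 0 := by
  ext i j
  simp [polyInner, MatrixMeasure.inner, value_zero]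

lemma polyInner_smul_left (ha : 2 < a ^ 2) (hζ : 0 ≤ ζ) (A : Matrix (Fin 2) (Fin 2) ℝ)
    (P R : MatPoly 2) : polyInner a ζ (A • P) R = A * polyInner a ζ P R := by
  ext i j
  have h (t : ℝ) : (value (A • P) t * (Waζ a ζ).density t * (value R t)ᵀ) i j =
      ∑ k, A i k * (value P t * (Waζ a ζ).density t * (value R t)ᵀ) k j := by
    rw [value_smul, mul_assoc A, mul_assoc A, Matrix.mul_apply]
  rw [Matrix.mul_apply]
  simp only [polyInner, MatrixMeasure.inner, Matrix.of_apply, h]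
  rw [integral_finsetSum _ fun k _ => (polyInner_integrable ha hζ P R k j).const_mul _]
  exact Finset.sum_congr rfl fun k _ => integral_const_mul _ _

lemma polyInner_sum_left (ha : 2 < a ^ 2) (hζ : 0 ≤ ζ) {ι : Type*} (s : Finset ι)
    (P : ι → MatPoly 2) (R : MatPoly 2) :
    polyInner a ζ (∑ k ∈ s, P k) R = ∑ k ∈ s, polyInner a ζ (P k) R := by
  classical
  induction s using Finset.induction_on with
  | empty => simp [polyInner_zero_left]
  | insert k s hk ih =>
    rw [Finset.sum_insert hk, Finset.sum_insert hk, polyInner_add_left ha hζ, ih]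

/-- Orthogonality to a set passes to its left span. -/
lemma polyInner_eq_zero_of_mem_span (ha : 2 < a ^ 2) (hζ : 0 ≤ ζ) {P R : MatPoly 2}
    {S : Set (MatPoly 2)} (h : ∀ Q ∈ S, polyInner a ζ P Q = 0)
    (hR : R ∈ Submodule.span (Matrix (Fin 2) (Fin 2) ℝ) S) : polyInner a ζ P R = 0 := by
  rw [← polyInner_transpose, Matrix.transpose_eq_zero]
  induction hR using Submodule.span_induction with
  | mem Q hQ => rw [← polyInner_transpose, h Q hQ, Matrix.transpose_zero]
  | zero => exact polyInner_zero_left _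
  | add Q Q' _ _ h h' => rw [polyInner_add_left ha hζ, h, h', add_zero]
  | smul c Q _ h => rw [polyInner_smul_left ha hζ, h, mul_zero]

/-- The quadratic form of the norm of `P` is positive at `v` unless the row `v P` vanishes. -/
lemma polyInner_quad_pos (ha : 2 < a ^ 2) (hζ : 0 ≤ ζ) (P : MatPoly 2) (k : ℕ) {v : Fin 2 → ℝ}
    (hv : v ᵥ* P.coeff k ≠ 0) : 0 < v ⬝ᵥ polyInner a ζ P P *ᵥ v := by
  obtain ⟨hi, he⟩ := quad_integral (polyInner_integrable (ζ := ζ) ha hζ P P) v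
  have hq (t : ℝ) : v ⬝ᵥ (value P t * (Waζ a ζ).density t * (value P t).transpose) *ᵥ v =
      (v ᵥ* value P t) ⬝ᵥ (Waζ a ζ).density t *ᵥ (v ᵥ* value P t) := by
    rw [← Matrix.mulVec_mulVec, ← Matrix.mulVec_mulVec, Matrix.dotProduct_mulVec,
      Matrix.mulVec_transpose]
  simp only [hq] at hi he
  rw [polyInner, MatrixMeasure.inner, he, ← setIntegral_univ]
  refine setIntegral_quad_pos ha (by simp) hi.integrableOn ?_
  obtain ⟨j, hj⟩ := Function.ne_iff.1 hv
  let q : ℝ[X] := ∑ i, C (v i) * matPolyEquiv.symm P i j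
  have hq0 : q ≠ 0 := by
    intro h0
    apply hj
    have := congrArg (fun p : ℝ[X] => p.coeff k) h0
    simpa [q, finsetSum_coeff, Matrix.vecMul, dotProduct, matPolyEquiv_symm_apply_coeff] using this
  refine compl_mem_ae_iff.2 (measure_mono_null (fun t ht => ?_)
    ((q.rootSet_finite ℝ).measure_zero volume))
  have h0 : v ᵥ* value P t = 0 := ht
  rw [mem_rootSet]
  refine ⟨hq0, ?_⟩
  have := congrFun h0 j
  simpa [q, Matrix.vecMul, dotProduct, value_apply, eval_finsetSum] using this

lemma polyInner_isHermitian (P : MatPoly 2) : (polyInner a ζ P P).IsHermitian := by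
  rw [Matrix.IsHermitian, Matrix.conjTranspose_eq_transpose_of_trivial, polyInner_transpose]

lemma polyInner_posDef (ha : 2 < a ^ 2) (hζ : 0 ≤ ζ) {P : MatPoly 2}
    (hP : IsUnit P.leadingCoeff) : (polyInner a ζ P P).PosDef := by
  refine .of_dotProduct_mulVec_pos (polyInner_isHermitian P) fun v hv => ?_
  rw [star_trivial]
  refine polyInner_quad_pos ha hζ P P.natDegree fun h => hv ?_
  obtain ⟨u, hu⟩ := hP
  have h1 : P.coeff P.natDegree = u := hu.symm
  have h2 := congrArg (fun w => w ᵥ* (↑u⁻¹ : Matrix (Fin 2) (Fin 2) ℝ)) h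
  simpa [h1, Matrix.vecMul_vecMul] using h2

lemma eq_zero_of_polyInner_self (ha : 2 < a ^ 2) (hζ : 0 ≤ ζ) {P : MatPoly 2}
    (hP : polyInner a ζ P P = 0) : P = 0 := by
  by_contra hne
  obtain ⟨k, hk⟩ : ∃ k, P.coeff k ≠ 0 := by
    by_contra! h
    exact hne (Polynomial.ext h)
  obtain ⟨i, hi⟩ : ∃ i, P.coeff k i ≠ 0 := Function.ne_iff.1 hk
  have h := polyInner_quad_pos (ζ := ζ) ha hζ P k (v := Pi.single i 1) (by
    rwa [Matrix.single_one_vecMul])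
  rw [hP] at h
  simp at h

/-! ### Orthogonalization -/

/-- Gram-Schmidt orthogonalization of the powers `K^n`, `n ≠ 1`, of `K(t) = t + N`. -/
noncomputable def orthP (a ζ : ℝ) (n : ℕ) : MatPoly 2 :=
  kPoly a ^ n - ∑ k : Fin n, if (k : ℕ) = 1 then 0 else
    (polyInner a ζ (kPoly a ^ n) (orthP a ζ k) *
      (polyInner a ζ (orthP a ζ k) (orthP a ζ k))⁻¹) • orthP a ζ k
termination_by n
decreasing_by exact k.isLt

lemma orthP_spec (ha : 2 < a ^ 2) (hζ : 0 ≤ ζ) (n : ℕ) (hn : n ≠ 1) :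
    (orthP a ζ n).Monic ∧ (orthP a ζ n).natDegree = n ∧ orthP a ζ n ∈ excSpace a ∧
      ∀ k < n, k ≠ 1 → polyInner a ζ (orthP a ζ n) (orthP a ζ k) = 0 := by
  induction n using Nat.strong_induction_on with
  | _ n ih =>
  have hK : (kPoly a ^ n).Monic := (monic_kPoly a).pow n
  have hKd : (kPoly a ^ n).degree = n := by
    rw [degree_eq_natDegree hK.ne_zero, (monic_kPoly a).natDegree_pow, kPoly, natDegree_X_add_C,
      mul_one]
  set L := ∑ k : Fin n, if (k : ℕ) = 1 then 0 else
    (polyInner a ζ (kPoly a ^ n) (orthP a ζ k) *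
      (polyInner a ζ (orthP a ζ k) (orthP a ζ k))⁻¹) • orthP a ζ k with hL
  have hP : orthP a ζ n = kPoly a ^ n - L := by rw [orthP]
  have hLd : L.degree < (kPoly a ^ n).degree := by
    rw [hKd, ← mem_degreeLT]
    refine Submodule.sum_mem _ fun k _ => ?_
    split_ifs with hk
    · exact zero_mem _
    · refine Submodule.smul_mem _ _ (mem_degreeLT.2 ?_)
      refine degree_le_natDegree.trans_lt ?_
      rw [(ih k k.isLt hk).2.1]
      exact_mod_cast k.isLt
  have hmonic : (orthP a ζ n).Monic := hP ▸ hK.sub_of_left hLd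
  refine ⟨hmonic, ?_, ?_, fun j hj hj1 => ?_⟩
  · apply natDegree_eq_of_degree_eq_some
    rw [hP, degree_sub_eq_left_of_degree_lt hLd, hKd]
  · rw [hP]
    refine sub_mem (kPoly_pow_mem n hn) (Submodule.sum_mem _ fun k _ => ?_)
    split_ifs with hk
    · exact zero_mem _
    · exact Submodule.smul_mem _ _ (ih k k.isLt hk).2.2.1
  · rw [hP, polyInner_sub_left ha hζ, hL, polyInner_sum_left ha hζ,
      Finset.sum_eq_single (⟨j, hj⟩ : Fin n)]
    · have hu : IsUnit (polyInner a ζ (orthP a ζ j) (orthP a ζ j)).det :=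
        (polyInner_posDef ha hζ (by rw [(ih j hj hj1).1]; exact isUnit_one)).det_pos.ne'.isUnit
      rw [if_neg hj1, polyInner_smul_left ha hζ, mul_assoc, Matrix.nonsing_inv_mul _ hu, mul_one,
        sub_self]
    · intro k _ hkj
      split_ifs with hk
      · exact polyInner_zero_left _
      · rw [polyInner_smul_left ha hζ]
        have hne : (k : ℕ) ≠ j := fun h => hkj (Fin.ext h)
        rcases lt_or_gt_of_ne hne with h | h
        · rw [← polyInner_transpose (orthP a ζ j), (ih j hj hj1).2.2.2 k h hk,
            Matrix.transpose_zero, mul_zero]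
        · rw [(ih k k.isLt hk).2.2.2 j h hj1, mul_zero]
    · exact fun h => absurd (Finset.mem_univ _) h

lemma orthP_basis (ha : 2 < a ^ 2) (hζ : 0 ≤ ζ) (n : ℕ) (hn : n ≠ 1) :
    orthP a ζ n ∈ excSpace a ∧ (orthP a ζ n).natDegree = n ∧
      IsUnit (orthP a ζ n).leadingCoeff := by
  obtain ⟨h1, h2, h3, -⟩ := orthP_spec ha hζ n hn
  exact ⟨h3, h2, h1 ▸ isUnit_one⟩

lemma polyInner_orthP (ha : 2 < a ^ 2) (hζ : 0 ≤ ζ) {n : ℕ} (hn : n ≠ 1) {R : MatPoly 2}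
    (hR : R ∈ excSpace a) (hd : R.degree < n) : polyInner a ζ (orthP a ζ n) R = 0 := by
  refine polyInner_eq_zero_of_mem_span ha hζ ?_
    (mem_span_of_degree_lt (fun Q hQ h0 => natDegree_notMem_of_mem_excSpace hQ h0)
      (fun k hk => orthP_basis ha hζ k hk) n R hR hd)
  rintro _ ⟨k, ⟨hk, hk1⟩, rfl⟩
  exact (orthP_spec ha hζ n hn).2.2.2 k hk hk1

lemma degree_sub_lt_of_coeff {P Q : MatPoly 2} {n : ℕ} (hP : P.natDegree ≤ n)
    (hQ : Q.natDegree ≤ n) (h : P.coeff n = Q.coeff n) : (P - Q).degree < n := by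
  refine (degree_lt_iff_coeff_zero _ _).2 fun m hm => ?_
  rw [coeff_sub]
  rcases hm.eq_or_lt with rfl | hm
  · rw [h, sub_self]
  · rw [coeff_eq_zero_of_natDegree_lt (hP.trans_lt hm),
      coeff_eq_zero_of_natDegree_lt (hQ.trans_lt hm), sub_zero]

/-- Uniqueness of monic orthogonal elements. -/
lemma eq_orthP (ha : 2 < a ^ 2) (hζ : 0 ≤ ζ) {n : ℕ} (hn : n ≠ 1) {P : MatPoly 2}
    (hP : P ∈ excSpace a) (hm : P.coeff n = 1) (hd : P.natDegree ≤ n)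
    (h : ∀ R ∈ excSpace a, R.degree < n → polyInner a ζ P R = 0) : orthP a ζ n = P := by
  obtain ⟨h1, h2, h3, -⟩ := orthP_spec ha hζ n hn
  have hlt : (orthP a ζ n - P).degree < n := by
    refine degree_sub_lt_of_coeff h2.le hd ?_
    rw [hm, ← h1.leadingCoeff, leadingCoeff, h2]
  have hmem := sub_mem h3 hP
  refine sub_eq_zero.1 (eq_zero_of_polyInner_self (a := a) (ζ := ζ) ha hζ ?_)
  rw [polyInner_sub_left ha hζ, polyInner_orthP ha hζ hn hmem hlt, h _ hmem hlt, sub_zero]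

/-- By symmetry `𝒟(P) - Γ P`, with `Γ` the coefficient of degree `n` of `𝒟(P)`, is orthogonal to
all elements of lower degree, of which it is one. -/
lemma exists_eigenvalue_orthP (ha : 2 < a ^ 2) (hζ : 0 ≤ ζ) {n : ℕ} (hn : n ≠ 1) :
    ∃ Γ : Matrix (Fin 2) (Fin 2) ℝ,
      ∀ t, (Da a).app (orthP a ζ n) t = Γ * value (orthP a ζ n) t := by
  obtain ⟨h1, h2, h3, -⟩ := orthP_spec ha hζ n hn
  obtain ⟨Q, hQ, hQd, hQv⟩ := exists_app_eq_value ha (n + 1) h3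
    (degree_le_natDegree.trans_lt (by rw [h2]; exact_mod_cast Nat.lt_succ_self n))
  have hQn : Q.natDegree ≤ n := natDegree_le_iff_degree_le.2 (Order.lt_succ_iff.1 hQd)
  refine ⟨Q.coeff n, fun t => ?_⟩
  set R := Q - Q.coeff n • orthP a ζ n with hR
  have hRm : R ∈ excSpace a := sub_mem hQ (Submodule.smul_mem _ _ h3)
  have hRd : R.degree < n := by
    refine degree_sub_lt_of_coeff hQn ((natDegree_smul_le _ _).trans h2.le) ?_
    have : (orthP a ζ n).coeff n = 1 := by
      rw [← h1.leadingCoeff, leadingCoeff, h2]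
    rw [coeff_smul, this, smul_eq_mul, mul_one]
  have hR0 : R = 0 := by
    refine eq_zero_of_polyInner_self (a := a) (ζ := ζ) ha hζ ?_
    have hQR : polyInner a ζ Q R = 0 := by
      obtain ⟨S, hS, hSd, hSv⟩ := exists_app_eq_value ha n hRm hRd
      have := inner_app ha hζ (orthP a ζ n) R
      rw [funext hQv, funext hSv] at this
      exact this.trans (polyInner_orthP ha hζ hn hS hSd)
    rw [polyInner_sub_left ha hζ Q, hQR, polyInner_smul_left ha hζ,
      polyInner_orthP ha hζ hn hRm hRd, mul_zero, sub_zero]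
  rw [hQv, ← value_smul, ← sub_eq_zero, ← value_sub, ← hR, hR0, value_zero]

end Positivity

/-! ### Orthogonality of the Hermite type polynomials -/

section Hermite

variable {a ζ : ℝ}

/-- Repeated integration by parts with `(exp (-t²) H_n)' = -exp (-t²) H_{n+1}`. -/
lemma integral_hermiteH_mul (n : ℕ) :
    ∀ q : ℝ[X], q.degree < n → ∫ t, Real.exp (-t ^ 2) * (hermiteH n * q).eval t = 0 := by
  induction n with
  | zero =>
    intro q hq
    have : q = 0 := by
      rw [← Polynomial.degree_eq_bot]
      exact Nat.WithBot.lt_zero_iff.1 (by simpa using hq)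
    simp [this]
  | succ n ih =>
    intro q hq
    rcases eq_or_ne q 0 with rfl | h0
    · simp
    have hd : (derivative q).degree < n :=
      (degree_derivative_lt h0).trans_le (Order.lt_succ_iff.1 hq)
    have hg (p : ℝ[X]) : Integrable fun t => Real.exp (-t ^ 2) * p.eval t :=
      (ExpGrowth.polynomial p).integrable_gaussian
    have hi : Integrable fun t => Real.exp (-t ^ 2) * (hermiteH n * derivative q).eval t -
        Real.exp (-t ^ 2) * (hermiteH (n + 1) * q).eval t := (hg _).sub (hg _)
    have key := integral_eq_zero_of_hasDerivAt_of_integrable (fun t => by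
      have he : HasDerivAt (fun s : ℝ => Real.exp (-s ^ 2)) (Real.exp (-t ^ 2) * (-(2 * t))) t := by
        convert ((hasDerivAt_pow 2 t).fun_neg).exp using 1
        norm_num
      refine (he.fun_mul (Polynomial.hasDerivAt (hermiteH n * q) t)).congr_deriv
        (g' := Real.exp (-t ^ 2) * (hermiteH n * derivative q).eval t -
          Real.exp (-t ^ 2) * (hermiteH (n + 1) * q).eval t) ?_
      simp only [hermiteH, derivative_mul, eval_add, eval_mul, eval_sub, eval_X, eval_ofNat]
      ring) hi (hg _)
    rw [integral_sub (hg _) (hg _), ih _ hd, zero_sub, neg_eq_zero] at key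
    exact key

lemma derivative_hermiteH (n : ℕ) :
    derivative (hermiteH (n + 1)) = 2 * ((n : ℝ[X]) + 1) * hermiteH n := by
  induction n with
  | zero => simp [hermiteH]
  | succ n ih =>
    have h : hermiteH (n + 2) = 2 * X * hermiteH (n + 1) - derivative (hermiteH (n + 1)) := rfl
    have h' : hermiteH (n + 1) = 2 * X * hermiteH n - derivative (hermiteH n) := rfl
    have h2 : derivative (2 * X : ℝ[X]) = 2 := by simp
    have h3 : derivative (2 * ((n : ℝ[X]) + 1)) = 0 := by simp
    rw [h, derivative_sub, derivative_mul, h2, ih, derivative_mul, h3]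
    push_cast
    linear_combination -2 * ((n : ℝ[X]) + 1) * h'

/-- The three term recurrence relation. -/
lemma X_mul_hermiteH (n : ℕ) (t : ℝ) :
    t * (hermiteH n).eval t = (hermiteH (n + 1)).eval t / 2 + n * (hermiteH (n - 1)).eval t := by
  rcases n with _ | n
  · simp [hermiteH]
  · have h : hermiteH (n + 2) = 2 * X * hermiteH (n + 1) - derivative (hermiteH (n + 1)) := rfl
    rw [h, derivative_hermiteH]
    simp
    ring

/-- The matrix `exp (-t²) W(t)` with respect to which the `P_n` are orthogonal. Its determinant is
negative, so it is not a weight matrix. -/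
noncomputable def hermiteWeight (a t : ℝ) : Matrix (Fin 2) (Fin 2) ℝ :=
  Real.exp (-t ^ 2) • !![1 - a ^ 2 + a ^ 2 * t ^ 2, a * t; a * t, 1]

lemma value_hermitePn (a : ℝ) (n : ℕ) (t : ℝ) :
    value (hermitePn a n) t =
      !![(hermiteH n).eval t, -n * a * (hermiteH (n - 1)).eval t;
        -n * a * (hermiteH (n - 1)).eval t,
        (1 - a ^ 2) * (hermiteH n).eval t + n * a ^ 2 * t * (hermiteH (n - 1)).eval t] := by
  rw [hermitePn, value_ofEntries]
  apply matrix_two_ext <;> simp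

/-- By the three term recurrence the entries involve only `H_n` and `H_{n+1}`, with a factor `t`
only next to `H_{n+1}`. -/
lemma hermitePn_mul_weight (a : ℝ) (n : ℕ) (t : ℝ) :
    value (hermitePn a n) t * hermiteWeight a t = Real.exp (-t ^ 2) •
      !![(1 - a ^ 2) * (hermiteH n).eval t + a ^ 2 / 2 * ((hermiteH (n + 1)).eval t * t),
          a / 2 * (hermiteH (n + 1)).eval t;
        a * (1 - a ^ 2) / 2 * (hermiteH (n + 1)).eval t, (1 - a ^ 2) * (hermiteH n).eval t] := by
  have h := X_mul_hermiteH n t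
  rw [value_hermitePn, hermiteWeight, Matrix.mul_smul]
  congr 1
  apply matrix_two_ext <;> simp only [Matrix.mul_apply, Fin.sum_univ_two, Matrix.of_apply,
    Matrix.cons_val', Matrix.cons_val_zero, Matrix.cons_val_one, Matrix.cons_val_fin_one]
  · linear_combination a ^ 2 * t * h
  · linear_combination a * h
  · linear_combination a * (1 - a ^ 2) * h
  · ring

/-- Orthogonality of `P_n` to all polynomials of lower degree. -/
lemma integral_hermitePn (a : ℝ) (n : ℕ) {Y : MatPoly 2} (hY : Y.degree < n) (i j : Fin 2) :
    ∫ t, (value (hermitePn a n) t * hermiteWeight a t * (value Y t).transpose) i j = 0 := by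
  have hd (k : Fin 2) : (matPolyEquiv.symm Y j k).degree < n := by
    refine (degree_lt_iff_coeff_zero _ _).2 fun m hm => ?_
    rw [matPolyEquiv_symm_apply_coeff, (degree_lt_iff_coeff_zero _ _).1 hY m hm, Matrix.zero_apply]
  have hd1 (k : Fin 2) : (matPolyEquiv.symm Y j k).degree < (n + 1 : ℕ) :=
    (hd k).trans (by exact_mod_cast Nat.lt_succ_self n)
  have hX (k : Fin 2) : (X * matPolyEquiv.symm Y j k).degree < ((n + 1 : ℕ) : WithBot ℕ) := by
    refine (degree_lt_iff_coeff_zero _ _).2 fun m hm => ?_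
    obtain ⟨m, rfl⟩ : ∃ l, m = l + 1 := ⟨m - 1, by omega⟩
    rw [coeff_X_mul, (degree_lt_iff_coeff_zero _ _).1 (hd k) m (by omega)]
  have hg (p : ℝ[X]) : Integrable fun t => Real.exp (-t ^ 2) * p.eval t :=
    (ExpGrowth.polynomial p).integrable_gaussian
  have hlin (c₁ c₂ : ℝ) (p₁ p₂ : ℝ[X]) (h₁ : ∫ t, Real.exp (-t ^ 2) * p₁.eval t = 0)
      (h₂ : ∫ t, Real.exp (-t ^ 2) * p₂.eval t = 0) :
      ∫ t, Real.exp (-t ^ 2) * (C c₁ * p₁ + C c₂ * p₂).eval t = 0 := by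
    have : (fun t => Real.exp (-t ^ 2) * (C c₁ * p₁ + C c₂ * p₂).eval t) = fun t =>
        c₁ * (Real.exp (-t ^ 2) * p₁.eval t) + c₂ * (Real.exp (-t ^ 2) * p₂.eval t) := by
      ext t
      simp
      ring
    rw [this, integral_add ((hg _).const_mul _) ((hg _).const_mul _), integral_const_mul,
      integral_const_mul, h₁, h₂]
    ring
  have h0 (k : Fin 2) := integral_hermiteH_mul n _ (hd k)
  have h1 (k : Fin 2) := integral_hermiteH_mul (n + 1) _ (hd1 k)
  have h2 (k : Fin 2) := integral_hermiteH_mul (n + 1) _ (hX k)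
  simp only [hermitePn_mul_weight, Matrix.smul_apply, smul_eq_mul,
    Matrix.mul_apply, Fin.sum_univ_two, Matrix.transpose_apply, value_apply]
  fin_cases i
  · refine Eq.trans ?_ (hlin 1 (a / 2) _ _ (hlin (1 - a ^ 2) (a ^ 2 / 2) _ _ (h0 0) (h2 0)) (h1 1))
    congr 1
    ext t
    simp
    ring
  · refine Eq.trans ?_ (hlin (a * (1 - a ^ 2) / 2) (1 - a ^ 2) _ _ (h1 0) (h0 1))
    congr 1
    ext t
    simp
    ring

/-! ### The adjoint of the Darboux operator -/

/-- The derivative of `𝒲ₐ`. -/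
noncomputable def WaDeriv (a t : ℝ) : Matrix (Fin 2) (Fin 2) ℝ :=
  (Real.exp (-t ^ 2) / pfun a t ^ (2 + 1)) •
    !![pfun a t * (a ^ 2 / (4 * (a ^ 2 - 2)) * (2 * pfun a t * (4 * (2 - a ^ 2) * t)) +
            4 * (2 - a ^ 2) * t / (a ^ 2 - 2) - 2 * t *
          (a ^ 2 / (4 * (a ^ 2 - 2)) * pfun a t ^ 2 + pfun a t / (a ^ 2 - 2) - a ^ 2)) -
          (2 : ℕ) * (4 * (2 - a ^ 2) * t) *
          (a ^ 2 / (4 * (a ^ 2 - 2)) * pfun a t ^ 2 + pfun a t / (a ^ 2 - 2) - a ^ 2),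
        pfun a t * (a * (4 * (2 - a ^ 2) * t / (a ^ 2 - 2)) * t +
            a * (pfun a t / (a ^ 2 - 2) - 2) -
          2 * t * (a * (pfun a t / (a ^ 2 - 2) - 2) * t)) -
          (2 : ℕ) * (4 * (2 - a ^ 2) * t) * (a * (pfun a t / (a ^ 2 - 2) - 2) * t);
      pfun a t * (a * (4 * (2 - a ^ 2) * t / (a ^ 2 - 2)) * t +
            a * (pfun a t / (a ^ 2 - 2) - 2) -
          2 * t * (a * (pfun a t / (a ^ 2 - 2) - 2) * t)) -
          (2 : ℕ) * (4 * (2 - a ^ 2) * t) * (a * (pfun a t / (a ^ 2 - 2) - 2) * t),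
        pfun a t * (2 * (-(4 * (2 - a ^ 2) * t)) / (a ^ 2 - 2) ^ 2 -
          2 * t * (2 * (a ^ 2 * (a ^ 2 - 2) - pfun a t) / (a ^ 2 - 2) ^ 2)) -
          (2 : ℕ) * (4 * (2 - a ^ 2) * t) *
          (2 * (a ^ 2 * (a ^ 2 - 2) - pfun a t) / (a ^ 2 - 2) ^ 2)]

lemma hasMatDeriv_Wa (ha : 2 < a ^ 2) : HasMatDeriv (Wa a) (WaDeriv a) := by
  have h00 (t : ℝ) : HasDerivAt
      (fun s => a ^ 2 / (4 * (a ^ 2 - 2)) * pfun a s ^ 2 + pfun a s / (a ^ 2 - 2) - a ^ 2)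
      (a ^ 2 / (4 * (a ^ 2 - 2)) * (2 * pfun a t * (4 * (2 - a ^ 2) * t)) +
        4 * (2 - a ^ 2) * t / (a ^ 2 - 2)) t := by
    refine (((((hasDerivAt_pfun a t).fun_pow 2).const_mul _).add
      ((hasDerivAt_pfun a t).div_const _)).sub_const _).congr_deriv ?_
    norm_num
  have h01 (t : ℝ) : HasDerivAt (fun s => a * (pfun a s / (a ^ 2 - 2) - 2) * s)
      (a * (4 * (2 - a ^ 2) * t / (a ^ 2 - 2)) * t + a * (pfun a t / (a ^ 2 - 2) - 2)) t := by
    refine (((((hasDerivAt_pfun a t).div_const _).sub_const 2).const_mul a).fun_mul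
      (hasDerivAt_id t)).congr_deriv ?_
    simp
  have h11 (t : ℝ) : HasDerivAt
      (fun s => 2 * (a ^ 2 * (a ^ 2 - 2) - pfun a s) / (a ^ 2 - 2) ^ 2)
      (2 * (-(4 * (2 - a ^ 2) * t)) / (a ^ 2 - 2) ^ 2) t :=
    (((hasDerivAt_pfun a t).const_sub _).const_mul 2).div_const _
  exact hasMatDeriv_two (fun t => hasDerivAt_gauss ha 2 (h00 t))
    (fun t => hasDerivAt_gauss ha 2 (h01 t)) (fun t => hasDerivAt_gauss ha 2 (h01 t))
    (fun t => hasDerivAt_gauss ha 2 (h11 t))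

lemma hasMatDeriv_kPoly_mul_Wa (ha : 2 < a ^ 2) :
    HasMatDeriv (fun t => value (kPoly a) t * Wa a t) fun t => hermiteWeight a t *
      !![-1 / (2 * (a ^ 2 - 2)), 0; 0, 1 / (a ^ 2 - 2) ^ 2] - Wa a t := by
  have hb : a ^ 2 - 2 ≠ 0 := by linarith
  have hW := hasMatDeriv_Wa ha
  have hd : derivative (kPoly a) = 1 := by simp [kPoly]
  have hK := (hasMatDeriv_value (kPoly a)).mul hW
  intro t i j
  refine (hK t i j).congr_deriv (congrFun (congrFun ?_ i) j)
  have hp := pfun_ne_zero ha t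
  have h0 : pfun a t = 2 * (2 - a ^ 2) * t ^ 2 - a ^ 2 := rfl
  rw [hd, value_one, value_kPoly, one_mul, hermiteWeight]
  apply matrix_two_ext <;>
    simp only [Wa, WaDeriv, Matrix.mul_apply, Fin.sum_univ_two, Matrix.add_apply, Matrix.sub_apply,
      Matrix.smul_apply, smul_eq_mul, Matrix.of_apply, Matrix.cons_val', Matrix.cons_val_zero,
      Matrix.cons_val_one, Matrix.cons_val_fin_one] <;>
    field_simp <;> rw [h0] <;> ring

lemma kPoly_mul_Wa_mul_transpose (ha : 2 < a ^ 2) (t : ℝ) :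
    value (kPoly a) t * Wa a t * (value (kPoly a) t).transpose = hermiteWeight a t *
      !![-1 / (2 * (a ^ 2 - 2) ^ 2), 0;
        a ^ 3 / (4 * (a ^ 2 - 2) ^ 2) * t, 1 / (4 * (a ^ 2 - 2))] := by
  have hb : a ^ 2 - 2 ≠ 0 := by linarith
  have hp := pfun_ne_zero ha t
  have h0 : pfun a t = 2 * (2 - a ^ 2) * t ^ 2 - a ^ 2 := rfl
  rw [value_kPoly, hermiteWeight]
  apply matrix_two_ext <;>
    simp only [Wa, Matrix.mul_apply, Fin.sum_univ_two, Matrix.transpose_apply,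
      Matrix.smul_apply, smul_eq_mul, Matrix.of_apply, Matrix.cons_val', Matrix.cons_val_zero,
      Matrix.cons_val_one, Matrix.cons_val_fin_one] <;>
    field_simp <;> rw [h0] <;> ring

/-- Up to sign, the composition of `𝒜` with its formal adjoint with respect to `hermiteWeight` and
`𝒲ₐ`. It is a second order operator with polynomial coefficients that does not raise degrees. -/
noncomputable def opAdj (a : ℝ) (y : MatPoly 2) : MatPoly 2 :=
  opA a y * C !![-1 / (2 * (a ^ 2 - 2)), 0; 0, 1 / (a ^ 2 - 2) ^ 2] +
    derivative (derivative y) * (C !![0, a ^ 3 / (4 * (a ^ 2 - 2) ^ 2); 0, 0] * X +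
      C !![-1 / (2 * (a ^ 2 - 2) ^ 2), 0; 0, 1 / (4 * (a ^ 2 - 2))])

lemma natDegree_opAdj_le (ha : 2 < a ^ 2) (y : MatPoly 2) :
    (opAdj a y).natDegree ≤ y.natDegree := by
  have hlin (U V : Matrix (Fin 2) (Fin 2) ℝ) : (C U * X + C V).natDegree ≤ 1 :=
    natDegree_linear_le
  refine natDegree_add_le_of_degree_le
    ((natDegree_mul_C_le _ _).trans (natDegree_opA_le ha y)) ?_
  rcases Nat.eq_zero_or_pos y.natDegree with h0 | h0
  · obtain ⟨c, rfl⟩ := natDegree_eq_zero.1 h0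
    rw [derivative_C, derivative_zero, zero_mul, natDegree_zero]
    exact Nat.zero_le _
  · have h1 := natDegree_derivative_le y
    have h2 := natDegree_derivative_le (derivative y)
    refine natDegree_mul_le.trans ?_
    have := hlin !![0, a ^ 3 / (4 * (a ^ 2 - 2) ^ 2); 0, 0]
      !![-1 / (2 * (a ^ 2 - 2) ^ 2), 0; 0, 1 / (4 * (a ^ 2 - 2))]
    omega

lemma value_opAdj (a : ℝ) (y : MatPoly 2) (t : ℝ) :
    (value (opAdj a y) t).transpose =
      !![-1 / (2 * (a ^ 2 - 2)), 0; 0, 1 / (a ^ 2 - 2) ^ 2] * (value (opA a y) t).transpose +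
        !![-1 / (2 * (a ^ 2 - 2) ^ 2), 0;
          a ^ 3 / (4 * (a ^ 2 - 2) ^ 2) * t, 1 / (4 * (a ^ 2 - 2))] *
          (value (derivative (derivative y)) t).transpose := by
  have h1 : (!![-1 / (2 * (a ^ 2 - 2)), 0; 0, 1 / (a ^ 2 - 2) ^ 2] :
      Matrix (Fin 2) (Fin 2) ℝ).transpose =
      !![-1 / (2 * (a ^ 2 - 2)), 0; 0, 1 / (a ^ 2 - 2) ^ 2] := by
    apply matrix_two_ext <;> rfl
  have h2 : (value (C !![0, a ^ 3 / (4 * (a ^ 2 - 2) ^ 2); 0, 0] * X +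
      C !![-1 / (2 * (a ^ 2 - 2) ^ 2), 0; 0, 1 / (4 * (a ^ 2 - 2))]) t).transpose =
      !![-1 / (2 * (a ^ 2 - 2) ^ 2), 0;
        a ^ 3 / (4 * (a ^ 2 - 2) ^ 2) * t, 1 / (4 * (a ^ 2 - 2))] := by
    rw [value_add, value_mul, value_C, value_C, value_X]
    apply matrix_two_ext <;> simp
    ring
  rw [opAdj, value_add, value_mul, value_mul, value_C, Matrix.transpose_add, Matrix.transpose_mul,
    Matrix.transpose_mul, h1, h2]

lemma gaussGrowth_hermiteWeight (a : ℝ) : GaussGrowth (hermiteWeight a) := by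
  refine ⟨fun t => !![1 - a ^ 2 + a ^ 2 * t ^ 2, a * t; a * t, 1], MatGrowth.of_polynomial
    !![C (1 - a ^ 2) + C (a ^ 2) * X ^ 2, C a * X; C a * X, 1] fun t i j => ?_, fun _ => rfl⟩
  fin_cases i <;> fin_cases j <;> simp

/-- Integration by parts moves `𝒜` to the other side: the difference of the integrands is the
derivative of `P K 𝒲ₐ 𝒜(y)ᵀ`. -/
lemma innerWa_opA (ha : 2 < a ^ 2) (P y : MatPoly 2) (i j : Fin 2) :
    innerWa a (value (opA a P)) (value (opA a y)) i j =
      -∫ t, (value P t * hermiteWeight a t * (value (opAdj a y) t).transpose) i j := by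
  have gP := MatGrowth.value P
  have gR := (MatGrowth.value (opA a y)).transpose
  have gB := gP.mul_gauss (((MatGrowth.value (kPoly a)).mul_gauss (gaussGrowth_Wa ha)).mul gR)
  have hB := (hasMatDeriv_value P).mul ((hasMatDeriv_kPoly_mul_Wa ha).mul
    (hasMatDeriv_value (opA a y)).transpose)
  have g1 := gaussGrowth_inner ha (MatGrowth.value (opA a P)) (MatGrowth.value (opA a y))
  have g2 := (gP.mul_gauss (gaussGrowth_hermiteWeight a)).mul
    (MatGrowth.value (opAdj a y)).transpose
  have key := GaussGrowth.integral_deriv_eq_zero gB (g1.add g2) (by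
    intro t i j
    have hK := kPoly_mul_Wa_mul_transpose ha t
    have e : value (derivative P) t * (value (kPoly a) t * Wa a t * (value (opA a y) t).transpose) +
        value P t * ((hermiteWeight a t * !![-1 / (2 * (a ^ 2 - 2)), 0; 0, 1 / (a ^ 2 - 2) ^ 2] -
          Wa a t) * (value (opA a y) t).transpose +
          value (kPoly a) t * Wa a t * (value (derivative (opA a y)) t).transpose) =
        value (opA a P) t * Wa a t * (value (opA a y) t).transpose +
          value P t * hermiteWeight a t * (value (opAdj a y) t).transpose := by
      rw [derivative_opA ha, value_mul _ (kPoly a), Matrix.transpose_mul, value_opAdj,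
        opA_eq ha P, value_sub, value_mul]
      linear_combination (norm := noncomm_ring)
        value P t * hK * (value (derivative (derivative y)) t).transpose
    exact (hB t i j).congr_deriv (congrFun (congrFun e i) j)) i j
  simp only [Matrix.add_apply] at key
  rw [integral_add (g1.integrable i j) (g2.integrable i j)] at key
  exact eq_neg_of_add_eq_zero_left key

lemma innerWa_excP (ha : 2 < a ^ 2) {n k : ℕ} (hk : k < n) :
    innerWa a (value (excP a n)) (value (excP a k)) = 0 := by
  ext i j
  rw [excP, excP, innerWa_opA ha, integral_hermitePn, neg_zero, Matrix.zero_apply]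
  have h1 : (hermitePn a k).natDegree ≤ k :=
    natDegree_le_iff_coeff_eq_zero.2 fun m hm => (coeff_hermitePn a k).2 m hm
  refine degree_le_natDegree.trans_lt ?_
  exact_mod_cast ((natDegree_opAdj_le ha _).trans h1).trans_lt hk

/-! ### The polynomials without mass, and those of degree two and three -/

lemma polyInner_eq_add (ha : 2 < a ^ 2) (hζ : 0 ≤ ζ) (P Q : MatPoly 2) :
    polyInner a ζ P Q =
      polyInner a 0 P Q + ζ • (value P 0 * Mmat * (value Q 0).transpose) := by
  rw [polyInner, polyInner, inner_Waζ ha hζ (.value P) (.value Q),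
    inner_Waζ ha le_rfl (.value P) (.value Q), zero_smul, add_zero]

lemma polyInner_excP (ha : 2 < a ^ 2) {n : ℕ} {R : MatPoly 2}
    (hR : R ∈ excSpace a) (hd : R.degree < n) : polyInner a 0 (excP a n) R = 0 := by
  refine polyInner_eq_zero_of_mem_span ha le_rfl ?_
    (mem_span_of_degree_lt (fun Q hQ h0 => natDegree_notMem_of_mem_excSpace hQ h0)
      (fun k hk => excP_basis ha k hk) n R hR hd)
  rintro _ ⟨k, ⟨hk, -⟩, rfl⟩
  rw [polyInner, inner_Waζ ha le_rfl (.value _) (.value _), innerWa_excP ha hk, smul_zero,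
    zero_smul, add_zero]

lemma orthP_zero_mass (ha : 2 < a ^ 2) (n : ℕ) (hn : n ≠ 1) :
    ∃ K : Matrix (Fin 2) (Fin 2) ℝ, IsUnit K ∧ orthP a 0 n = K • excP a n := by
  obtain ⟨hm, hd, u, hu⟩ := excP_basis ha n hn
  refine ⟨↑u⁻¹, Units.isUnit _, eq_orthP ha le_rfl hn (Submodule.smul_mem _ _ hm) ?_
    ((natDegree_smul_le _ _).trans hd.le) fun R hR hRd => ?_⟩
  · have : (excP a n).coeff n = u := by rw [hu, leadingCoeff, hd]
    rw [coeff_smul, this, smul_eq_mul, Units.inv_mul]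
  · rw [polyInner_smul_left ha le_rfl, polyInner_excP ha hR hRd, mul_zero]

lemma value_derivative_ofEntries (A : Matrix (Fin 2) (Fin 2) ℝ[X]) (t : ℝ) :
    value (derivative (ofEntries A)) t = Matrix.of fun i j => (derivative (A i j)).eval t := by
  ext i j
  rw [value_apply, symm_derivative, ofEntries, AlgEquiv.symm_apply_apply, Matrix.of_apply]

lemma hermiteH_two : hermiteH 2 = 4 * X ^ 2 - 2 := by
  rw [hermiteH, hermiteH_one]
  simp
  ring

lemma hermiteH_three : hermiteH 3 = 8 * X ^ 3 - 12 * X := by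
  rw [hermiteH, derivative_hermiteH, hermiteH_two, hermiteH_one]
  push_cast
  ring

lemma value_excP_two (ha : 2 < a ^ 2) (t : ℝ) : value (excP a 2) t =
    (4 : ℝ) • !![t ^ 2 - (a ^ 2 + 2) / (2 * a ^ 2 - 4), -a * t;
      2 * a * t / (a ^ 2 - 2), t ^ 2 + 1 / 2] := by
  have hb : a ^ 2 - 2 ≠ 0 := by linarith
  have hb' : 2 * a ^ 2 - 4 = 2 * (a ^ 2 - 2) := by ring
  rw [excP, opA_eq ha, value_sub, value_mul, value_kPoly, hermitePn, value_derivative_ofEntries,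
    value_ofEntries, hermiteH_two, hb']
  apply matrix_two_ext <;>
    simp [hermiteH_one, Matrix.mul_apply, Fin.sum_univ_two, -map_sub, -map_pow] <;>
    field_simp <;> ring

lemma value_excP_three (ha : 2 < a ^ 2) (t : ℝ) : value (excP a 3) t =
    !![16, 0; 0, 8 * (a ^ 2 + 2)] *
      !![t ^ 3 - 3 * a ^ 2 * t / (2 * a ^ 2 - 4), -3 * a * t ^ 2 / 2;
        6 * a * t ^ 2 / (a ^ 4 - 4), t ^ 3 + 3 * a ^ 2 * t / (2 * a ^ 2 + 4)] := by
  have hb : a ^ 2 - 2 ≠ 0 := by linarith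
  have hc : a ^ 2 + 2 ≠ 0 := by linarith
  have hb' : 2 * a ^ 2 - 4 = 2 * (a ^ 2 - 2) := by ring
  have hc' : 2 * a ^ 2 + 4 = 2 * (a ^ 2 + 2) := by ring
  have hd : a ^ 4 - 4 = (a ^ 2 - 2) * (a ^ 2 + 2) := by ring
  rw [excP, opA_eq ha, value_sub, value_mul, value_kPoly, hermitePn, value_derivative_ofEntries,
    value_ofEntries, hermiteH_three, hb', hc', hd]
  apply matrix_two_ext <;>
    simp [hermiteH_two, Matrix.mul_apply, Fin.sum_univ_two, -map_sub, -map_pow] <;>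
    field_simp <;> ring

lemma leadingCoeff_excP (ha : 2 < a ^ 2) (n : ℕ) : (excP a n).coeff n =
    ((n : ℝ) - 1) • !![2 ^ n, 0; 0, 2 ^ n * (1 - a ^ 2 + n * a ^ 2 / 2)] := by
  rw [excP, coeff_opA ha, (coeff_hermitePn a n).2 (n + 1) (by omega), zero_mul, smul_zero, add_zero,
    (coeff_hermitePn a n).1]

lemma value_orthP_three (ha : 2 < a ^ 2) (hζ : 0 ≤ ζ) (t : ℝ) : value (orthP a ζ 3) t =
    !![t ^ 3 - 3 * a ^ 2 * t / (2 * a ^ 2 - 4), -3 * a * t ^ 2 / 2;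
      6 * a * t ^ 2 / (a ^ 4 - 4), t ^ 3 + 3 * a ^ 2 * t / (2 * a ^ 2 + 4)] := by
  have hc : a ^ 2 + 2 ≠ 0 := by linarith
  have hinv : !![1 / 16, 0; 0, 1 / (8 * (a ^ 2 + 2))] * !![16, 0; 0, 8 * (a ^ 2 + 2)] =
      (1 : Matrix (Fin 2) (Fin 2) ℝ) := by
    apply matrix_two_ext <;> simp [Matrix.mul_apply]
    field_simp
  obtain ⟨hm, hd, -⟩ := excP_basis ha 3 (by norm_num)
  have h : orthP a ζ 3 = !![1 / 16, 0; 0, 1 / (8 * (a ^ 2 + 2))] • excP a 3 := by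
    refine eq_orthP ha hζ (by norm_num) (Submodule.smul_mem _ _ hm) ?_
      ((natDegree_smul_le _ _).trans hd.le) fun R hR hRd => ?_
    · rw [coeff_smul, leadingCoeff_excP ha, smul_eq_mul, ← hinv]
      congr 1
      apply matrix_two_ext <;> simp <;> ring
    · -- `𝒫₃` vanishes at the origin, so the mass there does not contribute.
      have h0 : value (excP a 3) 0 = 0 := by
        rw [value_excP_three ha]
        apply matrix_two_ext <;> simp
      rw [polyInner_smul_left ha hζ, polyInner_eq_add ha hζ, polyInner_excP ha hR hRd, h0]
      simp
  rw [h, value_smul, value_excP_three ha, ← mul_assoc, hinv, one_mul]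

lemma orthP_zero (a ζ : ℝ) : orthP a ζ 0 = 1 := by
  rw [orthP]
  simp

/-- `-b⁻¹ t exp (-t²) / 𝔭(t)`, with `b = a² - 2`, is a primitive of the difference of the lower
diagonal entry of `𝒲ₐ` and `b⁻² exp (-t²)`. -/
lemma integral_Wa_one_one (ha : 2 < a ^ 2) :
    ∫ t, Wa a t 1 1 = Real.sqrt Real.pi / (a ^ 2 - 2) ^ 2 := by
  have hb : a ^ 2 - 2 ≠ 0 := by linarith
  have hg : Integrable fun t : ℝ => Real.exp (-t ^ 2) * (1 / (a ^ 2 - 2) ^ 2) :=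
    (ExpGrowth.const _).integrable_gaussian
  have hB : Integrable fun t : ℝ => Real.exp (-t ^ 2) / pfun a t ^ 1 * (-1 / (a ^ 2 - 2) * t) := by
    have := (((ExpGrowth.const (-1 / (a ^ 2 - 2))).mul .id).div_pfun_pow ha 1).integrable_gaussian
    refine this.congr (Filter.Eventually.of_forall fun t => ?_)
    simp only
    ring
  have key := integral_eq_zero_of_hasDerivAt_of_integrable (fun t =>
    (hasDerivAt_gauss ha 1 ((hasDerivAt_id t).const_mul (-1 / (a ^ 2 - 2)))).congr_deriv
      (g' := Wa a t 1 1 - Real.exp (-t ^ 2) * (1 / (a ^ 2 - 2) ^ 2)) (by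
        have hp := pfun_ne_zero ha t
        have h0 : pfun a t = 2 * (2 - a ^ 2) * t ^ 2 - a ^ 2 := rfl
        simp only [Wa, Matrix.smul_apply, smul_eq_mul, Matrix.of_apply, Matrix.cons_val',
          Matrix.cons_val_one, Matrix.cons_val_fin_one, id, Nat.cast_one]
        field_simp
        rw [h0]
        ring)) ((integrable_Wa ha 1 1).sub hg) hB
  rw [integral_sub (integrable_Wa ha 1 1) hg, integral_mul_const, sub_eq_zero] at key
  have hpi : ∫ t : ℝ, Real.exp (-t ^ 2) = Real.sqrt Real.pi := by
    simpa using integral_gaussian 1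
  rw [key, hpi]
  ring

lemma integral_Wa_one_zero (a : ℝ) : ∫ t, Wa a t 1 0 = 0 := by
  have h : ∀ t, Wa a (-t) 1 0 = -Wa a t 1 0 := fun t => by
    simp [Wa, pfun]
  have h2 := integral_neg_eq_self (fun t => Wa a t 1 0) volume
  simp only [h, integral_neg] at h2
  linarith

lemma value_orthP_two (ha : 2 < a ^ 2) (hζ : 0 ≤ ζ) (t : ℝ) : value (orthP a ζ 2) t =
    !![t ^ 2 - (a ^ 2 + 2) / (2 * a ^ 2 - 4), -a * t;
      2 * a * t / (a ^ 2 - 2), t ^ 2 + 1 / (2 * (ζ * (a ^ 2 - 2) ^ 2 + 1))] := by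
  have hb : a ^ 2 - 2 ≠ 0 := by linarith
  have hz : ζ * (a ^ 2 - 2) ^ 2 + 1 ≠ 0 := by positivity
  -- In the presence of the mass, a constant multiple `D` of the polynomial `1` corrects the
  -- polynomial `K 𝒫₂` for `ζ = 0`; `c` is fixed by orthogonality to the constants.
  set c : ℝ := 1 / (2 * (ζ * (a ^ 2 - 2) ^ 2 + 1)) - 1 / 2 with hc
  set D : Matrix (Fin 2) (Fin 2) ℝ := !![0, 0; 0, c] with hD
  set K : Matrix (Fin 2) (Fin 2) ℝ := (1 / 4 : ℝ) • 1 with hK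
  have hpi : Real.sqrt Real.pi ≠ 0 := (Real.sqrt_pos.2 Real.pi_pos).ne'
  obtain ⟨hm, hd, -⟩ := excP_basis ha 2 (by norm_num)
  have h1 : (1 : MatPoly 2) ∈ excSpace a := by simpa using kPoly_pow_mem (a := a) 0 (by norm_num)
  have hv (t : ℝ) : value (K • excP a 2 + D • 1) t =
      !![t ^ 2 - (a ^ 2 + 2) / (2 * a ^ 2 - 4), -a * t;
        2 * a * t / (a ^ 2 - 2), t ^ 2 + 1 / (2 * (ζ * (a ^ 2 - 2) ^ 2 + 1))] := by
    rw [value_add, value_smul, value_smul, value_excP_two ha, value_one, mul_one, hK,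
      Matrix.smul_mul, one_mul, smul_smul]
    apply matrix_two_ext <;> simp [hD, hc]
  have h : orthP a ζ 2 = K • excP a 2 + D • 1 := by
    refine eq_orthP ha hζ (by norm_num)
      (add_mem (Submodule.smul_mem _ _ hm) (Submodule.smul_mem _ _ h1)) ?_ ?_ fun R hR hRd => ?_
    · rw [coeff_add, coeff_smul, coeff_smul, leadingCoeff_excP ha, coeff_one, smul_eq_mul, hK]
      apply matrix_two_ext <;> simp <;> ring
    · exact natDegree_add_le_of_degree_le ((natDegree_smul_le _ _).trans hd.le)
        ((natDegree_smul_le _ _).trans (by simp))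
    · refine polyInner_eq_zero_of_mem_span ha hζ ?_
        (mem_span_of_degree_lt (fun Q hQ h0 => natDegree_notMem_of_mem_excSpace hQ h0)
          (fun k hk => orthP_basis ha hζ k hk) 2 R hR hRd)
      rintro _ ⟨k, ⟨hk, hk1⟩, rfl⟩
      have hk0 : k = 0 := by
        have : k ≠ 1 := hk1
        omega
      subst hk0
      have hI : D * polyInner a 0 1 1 = !![0, 0; 0, c * (1 / (a ^ 2 - 2) ^ 2)] := by
        have h1 (i j : Fin 2) : polyInner a 0 1 1 i j =
            1 / Real.sqrt Real.pi * ∫ t, Wa a t i j := by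
          rw [polyInner, inner_Waζ ha le_rfl (.value 1) (.value 1), zero_smul, add_zero, innerWa]
          simp [value_one]
        apply matrix_two_ext <;> rw [Matrix.mul_apply, Fin.sum_univ_two, h1, h1] <;>
          simp only [hD, Matrix.of_apply, Matrix.cons_val', Matrix.cons_val_zero,
            Matrix.cons_val_one, Matrix.cons_val_fin_one, integral_Wa_one_zero,
            integral_Wa_one_one ha, zero_mul, mul_zero, add_zero, zero_add]
        field_simp
      rw [orthP_zero, polyInner_eq_add ha hζ, polyInner_add_left ha le_rfl,
        polyInner_smul_left ha le_rfl, polyInner_smul_left ha le_rfl,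
        polyInner_excP ha h1 (by rw [degree_one]; norm_num), mul_zero, zero_add, hI, hv, value_one]
      apply matrix_two_ext <;> simp [Mmat, hc]
      field_simp
      ring
  rw [h, hv]

end Hermite

/-! ### Determinacy of moments -/

section Moments

open ProbabilityTheory

/-- The transform `z ↦ ∫ exp (z x) dν(x)` is entire, so it is determined by its Taylor series at the
origin, whose coefficients are the moments. -/
lemma measure_ext_of_moments {ν ν' : Measure ℝ} [IsFiniteMeasure ν] [IsFiniteMeasure ν']
    (h : integrableExpSet id ν = Set.univ) (h' : integrableExpSet id ν' = Set.univ)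
    (hm : ∀ n : ℕ, ∫ x, x ^ n ∂ν = ∫ x, x ^ n ∂ν') : ν = ν' := by
  have hdiff {ρ : Measure ℝ} (hρ : integrableExpSet id ρ = Set.univ) :
      Differentiable ℂ (complexMGF id ρ) := fun z =>
    (analyticAt_complexMGF (by rw [hρ]; simp)).differentiableAt
  have hderiv {ρ : Measure ℝ} (hρ : integrableExpSet id ρ = Set.univ) (n : ℕ) :
      iteratedDeriv n (complexMGF id ρ) 0 = ((∫ x, x ^ n ∂ρ : ℝ) : ℂ) := by
    rw [iteratedDeriv_complexMGF (by rw [hρ]; simp), ← integral_complex_ofReal]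
    simp
  refine Measure.ext_of_complexMGF_id_eq (funext fun z => ?_)
  rw [← Complex.taylorSeries_eq_of_entire' 0 z (hdiff h),
    ← Complex.taylorSeries_eq_of_entire' 0 z (hdiff h')]
  simp only [hderiv h, hderiv h', hm]

/-- A function that is integrable against all exponentials and all of whose moments vanish is zero:
the positive and the negative part are densities of measures with the same moments. -/
lemma ae_eq_zero_of_moments {μ : Measure ℝ} {h : ℝ → ℝ} (hh : Measurable h)
    (hexp : ∀ c : ℝ, Integrable (fun t => Real.exp (c * t) * h t) μ)
    (hpow : ∀ n : ℕ, Integrable (fun t => t ^ n * h t) μ)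
    (hm : ∀ n : ℕ, ∫ t, t ^ n * h t ∂μ = 0) : h =ᵐ[μ] 0 := by
  have hint : Integrable h μ := by simpa using hpow 0
  have hfin1 := isFiniteMeasure_withDensity_ofReal hint.2
  have hfin2 := isFiniteMeasure_withDensity_ofReal hint.neg.2
  have hm1 : Measurable fun t => ENNReal.ofReal (h t) := hh.ennreal_ofReal
  have hm2 : Measurable fun t => ENNReal.ofReal ((-h) t) := hh.neg.ennreal_ofReal
  have habs {f k : ℝ → ℝ} (hf : Continuous f) (hk : Measurable k) (hkh : ∀ t, |k t| = |h t|)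
      (hfi : Integrable (fun t => f t * h t) μ) :
      Integrable (fun t => (ENNReal.ofReal (k t)).toReal • f t) μ := by
    refine hfi.mono (hk.ennreal_ofReal.ennreal_toReal.mul hf.measurable).aestronglyMeasurable
      (Filter.Eventually.of_forall fun t => ?_)
    rw [smul_eq_mul, norm_mul, norm_mul, mul_comm, Real.norm_eq_abs, Real.norm_eq_abs,
      Real.norm_eq_abs, ENNReal.toReal_ofReal', ← hkh]
    refine mul_le_mul_of_nonneg_left ?_ (abs_nonneg _)
    rw [abs_of_nonneg (le_max_right _ _)]
    exact max_le (le_abs_self _) (abs_nonneg _)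
  have hset {k : ℝ → ℝ} (hk : Measurable k) (hkh : ∀ t, |k t| = |h t|) :
      integrableExpSet id (μ.withDensity fun t => ENNReal.ofReal (k t)) = Set.univ := by
    refine Set.eq_univ_of_forall fun c => ?_
    rw [integrableExpSet, Set.mem_ofPred_eq, integrable_withDensity_iff_integrable_smul'
      hk.ennreal_ofReal (Filter.Eventually.of_forall fun t => ENNReal.ofReal_lt_top)]
    exact habs (by fun_prop) hk hkh (hexp c)
  have hneg (t : ℝ) : |(-h) t| = |h t| := abs_neg _
  have key := measure_ext_of_moments (hset hh fun _ => rfl) (hset hh.neg hneg) fun n => by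
    rw [integral_withDensity_eq_integral_toReal_smul hm1
        (Filter.Eventually.of_forall fun t => ENNReal.ofReal_lt_top),
      integral_withDensity_eq_integral_toReal_smul hm2
        (Filter.Eventually.of_forall fun t => ENNReal.ofReal_lt_top), ← sub_eq_zero,
      ← integral_sub (habs (by fun_prop) hh (fun _ => rfl) (hpow n))
        (habs (by fun_prop) hh.neg hneg (hpow n)), ← hm n]
    refine integral_congr_ae (Filter.Eventually.of_forall fun t => ?_)
    simp only [smul_eq_mul, ENNReal.toReal_ofReal', Pi.neg_apply]
    rcases le_total (h t) 0 with h0 | h0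
    · rw [max_eq_right h0, max_eq_left (neg_nonneg.2 h0)]
      ring
    · rw [max_eq_left h0, max_eq_right (neg_nonpos.2 h0)]
      ring
  rw [withDensity_eq_iff hm1.aemeasurable hm2.aemeasurable
    ((lintegral_mono fun t => Real.ofReal_le_enorm (h t)).trans_lt hint.2).ne] at key
  filter_upwards [key] with t ht
  rcases le_total (h t) 0 with h0 | h0
  · rw [ENNReal.ofReal_of_nonpos h0, Pi.neg_apply, eq_comm, ENNReal.ofReal_eq_zero] at ht
    exact le_antisymm h0 (neg_nonpos.1 ht)
  · rw [Pi.neg_apply, ENNReal.ofReal_of_nonpos (neg_nonpos.2 h0), ENNReal.ofReal_eq_zero] at ht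
    exact le_antisymm ht h0

end Moments

/-! ### Density in the space of square integrable functions -/

section Density

open scoped Matrix InnerProductSpace

variable {N : ℕ}

lemma value_mul_map (R : MatPoly N) (q : ℝ[X]) (t : ℝ) :
    value (R * q.map (algebraMap ℝ (Matrix (Fin N) (Fin N) ℝ))) t = q.eval t • value R t := by
  have h : Matrix.scalar (Fin N) t = algebraMap ℝ (Matrix (Fin N) (Fin N) ℝ) t := rfl
  rw [value_mul, value, value, h, eval_map_algebraMap, aeval_algebraMap_apply,
    ← Algebra.commutes, ← Algebra.smul_def, coe_aeval_eq_eval]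

lemma value_monomial (n : ℕ) (A : Matrix (Fin N) (Fin N) ℝ) (t : ℝ) :
    value (monomial n A) t = t ^ n • A := by
  have h : Matrix.scalar (Fin N) t = algebraMap ℝ (Matrix (Fin N) (Fin N) ℝ) t := rfl
  rw [value, eval_monomial, h, ← map_pow, ← Algebra.commutes, ← Algebra.smul_def]

/-- The matrix function `F T`, as a vector function. If `W = T Tᵀ dμ`, then `F ↦ F T` is an
isometry of `L²(W)` into the space of square integrable vector functions. -/
noncomputable def mulFactor (T F : ℝ → Matrix (Fin N) (Fin N) ℝ) (t : ℝ) :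
    EuclideanSpace ℝ (Fin N × Fin N) :=
  WithLp.toLp 2 fun k => (F t * T t) k.1 k.2

lemma measurable_mulFactor {T F : ℝ → Matrix (Fin N) (Fin N) ℝ}
    (hT : ∀ i j, Measurable fun t => T t i j) (hF : ∀ i j, Measurable fun t => F t i j) :
    Measurable (mulFactor T F) := by
  refine (WithLp.measurable_toLp 2 _).comp (measurable_pi_lambda _ fun k => ?_)
  simp only [Matrix.mul_apply]
  exact Finset.measurable_sum _ fun l _ => (hF _ _).mul (hT _ _)

lemma normSq_eq_eLpNorm {W : MatrixMeasure N} {T : ℝ → Matrix (Fin N) (Fin N) ℝ}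
    (hW : ∀ t, W.density t = T t * (T t)ᵀ) (F : ℝ → Matrix (Fin N) (Fin N) ℝ) :
    W.normSq F = eLpNorm (mulFactor T F) 2 W.base ^ 2 := by
  have h := eLpNorm_nnreal_pow_eq_lintegral (f := mulFactor T F) (μ := W.base) (p := 2)
    (by norm_num)
  simp only [NNReal.coe_ofNat, ENNReal.rpow_ofNat, ENNReal.coe_ofNat] at h
  rw [h, MatrixMeasure.normSq]
  refine lintegral_congr fun t => ?_
  rw [← ofReal_norm, ← ENNReal.ofReal_pow (norm_nonneg _), EuclideanSpace.norm_sq_eq,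
    hW, Fintype.sum_prod_type, Matrix.trace]
  congr 1
  refine Finset.sum_congr rfl fun i _ => ?_
  have e : F t * (T t * (T t)ᵀ) * (F t)ᵀ = (F t * T t) * (F t * T t)ᵀ := by
    simp only [Matrix.transpose_mul, mul_assoc]
  rw [e, Matrix.diag_apply, Matrix.mul_apply]
  refine Finset.sum_congr rfl fun j _ => ?_
  rw [mulFactor, Real.norm_eq_abs, sq_abs, Matrix.transpose_apply, sq]

lemma memLp_growth_mul_factor {W : MatrixMeasure N} {T : ℝ → Matrix (Fin N) (Fin N) ℝ}
    (hT : ∀ i j, Measurable fun t => T t i j) (hW : ∀ t, W.density t = T t * (T t)ᵀ)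
    (hint : ∀ f, ExpGrowth f → ∀ k, Integrable (fun t => f t * W.density t k k) W.base)
    {f : ℝ → ℝ} (hf : ExpGrowth f) (k j : Fin N) : MemLp (fun t => f t * T t k j) 2 W.base := by
  have hm : Measurable fun t => f t * T t k j := hf.1.measurable.mul (hT k j)
  rw [memLp_two_iff_integrable_sq hm.aestronglyMeasurable]
  refine (hint _ (hf.pow 2) k).mono' (hm.pow_const 2).aestronglyMeasurable
    (Filter.Eventually.of_forall fun t => ?_)
  rw [Real.norm_eq_abs, abs_of_nonneg (sq_nonneg _), mul_pow, hW, Matrix.mul_apply]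
  refine mul_le_mul_of_nonneg_left ?_ (sq_nonneg _)
  simp only [Matrix.transpose_apply, ← sq]
  exact Finset.single_le_sum (f := fun l => T t k l ^ 2) (fun l _ => sq_nonneg _)
    (Finset.mem_univ j)

lemma memLp_mulFactor_value {W : MatrixMeasure N} {T : ℝ → Matrix (Fin N) (Fin N) ℝ}
    (hT : ∀ i j, Measurable fun t => T t i j) (hW : ∀ t, W.density t = T t * (T t)ᵀ)
    (hint : ∀ f, ExpGrowth f → ∀ k, Integrable (fun t => f t * W.density t k k) W.base)
    (Q : MatPoly N) : MemLp (mulFactor T (value Q)) 2 W.base := by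
  refine MemLp.of_eval_piLp fun k => ?_
  simp only [mulFactor, Matrix.mul_apply]
  exact memLp_finsetSum _ fun l _ => memLp_growth_mul_factor hT hW hint (MatGrowth.value Q _ _) _ _

/-- A space `A` that contains all multiples of a polynomial `q` without real zeros is dense if the
weight has exponential moments: for `g` orthogonal to `A`, the entries of `q g Tᵀ` have vanishing
moments, so that `g Tᵀ = 0`, and hence `g` is orthogonal to every `F T`. -/
theorem denseInL2_of_factor {W : MatrixMeasure N} {T : ℝ → Matrix (Fin N) (Fin N) ℝ}
    (hT : ∀ i j, Measurable fun t => T t i j) (hW : ∀ t, W.density t = T t * (T t)ᵀ)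
    (hint : ∀ f, ExpGrowth f → ∀ k, Integrable (fun t => f t * W.density t k k) W.base)
    {A : Submodule (Matrix (Fin N) (Fin N) ℝ) (MatPoly N)} {q : ℝ[X]}
    (hq : ∀ t, q.eval t ≠ 0)
    (hA : ∀ R : MatPoly N, R * q.map (algebraMap ℝ (Matrix (Fin N) (Fin N) ℝ)) ∈ A) :
    W.DenseInL2 A := by
  intro F hF hFn ε hε
  have hL (Q : MatPoly N) := memLp_mulFactor_value hT hW hint Q
  have hFL : MemLp (mulFactor T F) 2 W.base := by
    refine ⟨(measurable_mulFactor hT hF).aestronglyMeasurable, ?_⟩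
    rw [normSq_eq_eLpNorm hW] at hFn
    exact (ENNReal.pow_lt_top_iff.1 hFn).resolve_right (by norm_num)
  let V : Submodule ℝ (Lp (EuclideanSpace ℝ (Fin N × Fin N)) 2 W.base) :=
    { carrier := {f | ∃ Q ∈ A, f =ᵐ[W.base] mulFactor T (value Q)}
      zero_mem' := ⟨0, zero_mem _, by
        filter_upwards [Lp.coeFn_zero (EuclideanSpace ℝ (Fin N × Fin N)) 2 W.base] with t ht
        rw [ht]
        ext k
        simp [mulFactor, value_zero]⟩
      add_mem' := by
        rintro f g ⟨Q, hQ, hf⟩ ⟨R, hR, hg⟩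
        refine ⟨Q + R, add_mem hQ hR, ?_⟩
        filter_upwards [Lp.coeFn_add f g, hf, hg] with t ht hft hgt
        rw [ht, Pi.add_apply, hft, hgt]
        ext k
        simp [mulFactor, value_add, add_mul]
      smul_mem' := by
        rintro c f ⟨Q, hQ, hf⟩
        refine ⟨(c • (1 : Matrix (Fin N) (Fin N) ℝ)) • Q, A.smul_mem _ hQ, ?_⟩
        filter_upwards [Lp.coeFn_smul c f, hf] with t ht hft
        rw [ht, Pi.smul_apply, hft]
        ext k
        simp only [mulFactor, PiLp.smul_apply, value_smul, Matrix.smul_mul, one_mul,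
          Matrix.smul_apply] }
  have hmem : hFL.toLp ∈ Vᗮᗮ := by
    rw [Submodule.mem_orthogonal']
    intro g hg
    have hgm : Measurable g := (Lp.stronglyMeasurable g).measurable
    have hgi (i : Fin N × Fin N) : MemLp (fun t => g t i) 2 W.base := (Lp.memLp g).eval_piLp i
    have hgmi (i : Fin N × Fin N) : Measurable fun t => g t i := by fun_prop
    have hker (i k : Fin N) : ∀ᵐ t ∂W.base, ∑ j, T t k j * g t (i, j) = 0 := by
      have hi {f : ℝ → ℝ} (hf : ExpGrowth f) :
          Integrable (fun t => f t * (q.eval t * ∑ j, T t k j * g t (i, j))) W.base := by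
        have : Integrable (fun t => ∑ j, (f t * q.eval t * T t k j) * g t (i, j)) W.base :=
          integrable_finsetSum _ fun j _ => (memLp_growth_mul_factor hT hW hint
            (hf.mul (.polynomial q)) k j).integrable_mul (hgi (i, j))
        refine this.congr (Filter.Eventually.of_forall fun t => ?_)
        simp only [Finset.mul_sum, mul_assoc]
      -- Testing with `q tⁿ E_{ik}` gives the moments of this entry.
      have h0 : (fun t => q.eval t * ∑ j, T t k j * g t (i, j)) =ᵐ[W.base] 0 := by
        refine ae_eq_zero_of_moments ?_ (fun c => hi (.exp_mul c)) (fun n => hi (.pow .id n))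
          fun n => ?_
        · exact (q.continuous.measurable).mul (Finset.measurable_sum _ fun j _ =>
            (hT k j).mul (hgmi (i, j)))
        · set R : MatPoly N := monomial n (Matrix.single i k 1) *
            q.map (algebraMap ℝ (Matrix (Fin N) (Fin N) ℝ)) with hR
          have hv (t : ℝ) : value R t = (t ^ n * q.eval t) • Matrix.single i k 1 := by
            rw [hR, value_mul_map, value_monomial, smul_smul, mul_comm]
          have hRV : (hL R).toLp ∈ V := ⟨R, hA _, (hL R).coeFn_toLp⟩
          have h1 := (Submodule.mem_orthogonal _ _).1 hg _ hRV
          rw [L2.inner_def] at h1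
          rw [← h1]
          refine integral_congr_ae ?_
          filter_upwards [(hL R).coeFn_toLp] with t ht
          symm
          rw [ht, PiLp.inner_apply, Fintype.sum_prod_type, Finset.sum_eq_single i]
          · rw [← mul_assoc, Finset.mul_sum]
            refine Finset.sum_congr rfl fun j _ => ?_
            simp only [mulFactor, hv, Matrix.smul_mul, Matrix.smul_apply, smul_eq_mul,
              Matrix.single_mul_apply_same, RCLike.inner_apply, conj_trivial]
            ring
          · intro l _ hl
            refine Finset.sum_eq_zero fun j _ => ?_
            simp only [mulFactor, hv, Matrix.smul_mul, Matrix.smul_apply, smul_eq_mul,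
              Matrix.single_mul_apply_of_ne _ _ _ _ _ hl, RCLike.inner_apply, conj_trivial]
            ring
          · exact fun h => absurd (Finset.mem_univ _) h
      filter_upwards [h0] with t ht
      exact (mul_eq_zero.1 ht).resolve_left (hq t)
    rw [L2.inner_def]
    refine integral_eq_zero_of_ae ?_
    have hall : ∀ᵐ t ∂W.base, ∀ i k, ∑ j, T t k j * g t (i, j) = 0 :=
      ae_all_iff.2 fun i => ae_all_iff.2 fun k => hker i k
    filter_upwards [hFL.coeFn_toLp, hall] with t ht h
    rw [ht, PiLp.inner_apply, Fintype.sum_prod_type]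
    refine Finset.sum_eq_zero fun i _ => ?_
    have e (j : Fin N) : ⟪mulFactor T F t (i, j), g t (i, j)⟫_ℝ =
        ∑ l, F t i l * (T t l j * g t (i, j)) := by
      simp only [mulFactor, Matrix.mul_apply, RCLike.inner_apply, conj_trivial, Finset.mul_sum]
      exact Finset.sum_congr rfl fun l _ => by ring
    simp only [e]
    rw [Finset.sum_comm]
    refine Finset.sum_eq_zero fun l _ => ?_
    rw [← Finset.mul_sum, h, mul_zero]
  rw [Submodule.orthogonal_orthogonal_eq_closure] at hmem
  have hmem' : hFL.toLp ∈ closure (V : Set (Lp (EuclideanSpace ℝ (Fin N × Fin N)) 2 W.base)) := hmem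
  rw [EMetric.mem_closure_iff] at hmem'
  obtain ⟨f, ⟨Q, hQ, hfQ⟩, hd⟩ := hmem' (min ε 1) (lt_min hε one_pos)
  refine ⟨Q, hQ, ?_⟩
  have he : eLpNorm (mulFactor T fun t => F t - value Q t) 2 W.base = edist hFL.toLp f := by
    rw [Lp.edist_def]
    refine eLpNorm_congr_ae ?_
    filter_upwards [hFL.coeFn_toLp, hfQ] with t h1 h2
    rw [Pi.sub_apply, h1, h2]
    ext k
    simp [mulFactor, sub_mul]
  rw [normSq_eq_eLpNorm hW, he, sq]
  calc _ ≤ edist hFL.toLp f * 1 := by gcongr; exact (hd.trans_le (min_le_right _ _)).le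
    _ < ε := by rw [mul_one]; exact hd.trans_le (min_le_left _ _)

end Density

/-! ### Density of the exceptional space -/

section Complete

open scoped Matrix

variable {a ζ : ℝ}

lemma aeval_pPoly_nMat (ha : 2 < a ^ 2) : aeval (-nMat a) (pPoly a) = 0 := by
  have hb : a ^ 2 - 2 ≠ 0 := by linarith
  have hsq : nMat a * nMat a = (-a ^ 2 / (2 * (a ^ 2 - 2))) • (1 : Matrix (Fin 2) (Fin 2) ℝ) := by
    apply matrix_two_ext <;> simp [nMat, Matrix.mul_apply, Fin.sum_univ_two] <;> field_simp
  rw [pPoly, map_sub, map_mul, map_pow, aeval_C, aeval_C, aeval_X, neg_sq, sq (nMat a), hsq,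
    Algebra.algebraMap_eq_smul_one, Algebra.algebraMap_eq_smul_one, smul_mul_smul_comm, one_mul,
    ← sub_smul]
  convert zero_smul ℝ _
  field_simp
  ring

/-- The zeros of `𝔭` are the eigenvalues of `-N`, so derivatives of multiples of `𝔭²` vanish
at `-N`. -/
lemma mul_sq_mem_excSpace (ha : 2 < a ^ 2) (R : MatPoly 2) :
    R * (pPoly a ^ 2).map (algebraMap ℝ (Matrix (Fin 2) (Fin 2) ℝ)) ∈ excSpace a := by
  set s : MatPoly 2 := (pPoly a).map (algebraMap ℝ (Matrix (Fin 2) (Fin 2) ℝ)) with hs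
  have h1 : derivative (R * s ^ 2) =
      (derivative R * s + 2 * (R * derivative s)) * s := by
    have hc : derivative s * s = s * derivative s := by
      rw [hs, derivative_map, ← Polynomial.map_mul, ← Polynomial.map_mul, mul_comm]
    rw [sq, derivative_mul, derivative_mul, ← hc]
    noncomm_ring
  rw [Polynomial.map_pow, ← hs, mem_excSpace, h1, eval, eval₂_mul_noncomm, ← eval, ← eval]
  · rw [hs, eval_map_algebraMap, aeval_pPoly_nMat ha, mul_zero]
  · intro k
    rw [RingHom.id_apply, hs, coeff_map]
    exact Algebra.commutes _ _

/-- The upper triangular Cholesky factor of the density, which exists because the lower diagonal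
entry is positive everywhere, the origin included. -/
noncomputable def densityFactor (a ζ t : ℝ) : Matrix (Fin 2) (Fin 2) ℝ :=
  !![Real.sqrt (((Waζ a ζ).density t).det / (Waζ a ζ).density t 1 1),
      (Waζ a ζ).density t 0 1 / Real.sqrt ((Waζ a ζ).density t 1 1);
    0, Real.sqrt ((Waζ a ζ).density t 1 1)]

lemma measurable_density (ha : 2 < a ^ 2) (i j : Fin 2) :
    Measurable fun t => (Waζ a ζ).density t i j := by
  have h : (fun t => (Waζ a ζ).density t i j) = fun t => if t = 0 then Mmat i j else
      1 / Real.sqrt Real.pi * Wa a t i j := by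
    ext t
    by_cases ht : t = 0
    · rw [if_pos ht, ht, density_zero]
    · rw [if_neg ht, density_of_ne ht, Matrix.smul_apply, smul_eq_mul]
  obtain ⟨G, hG, hW⟩ := gaussGrowth_Wa ha
  have hc : Continuous fun t => Wa a t i j := by
    simp only [hW, Matrix.smul_apply, smul_eq_mul]
    exact (by fun_prop : Continuous fun t : ℝ => Real.exp (-t ^ 2)).mul (hG i j).1
  rw [h]
  exact Measurable.ite (measurableSet_singleton 0) measurable_const (hc.measurable.const_mul _)

lemma measurable_densityFactor (ha : 2 < a ^ 2) (i j : Fin 2) :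
    Measurable fun t => densityFactor a ζ t i j := by
  have h := measurable_density (ζ := ζ) ha
  have hd : Measurable fun t => ((Waζ a ζ).density t).det := by
    simp only [Matrix.det_fin_two]
    exact ((h 0 0).mul (h 1 1)).sub ((h 0 1).mul (h 1 0))
  have h00 := (hd.div (h 1 1)).sqrt
  have h01 := (h 0 1).div (h 1 1).sqrt
  have h11 := (h 1 1).sqrt
  fin_cases i <;> fin_cases j
  · exact h00
  · exact h01
  · exact measurable_const
  · exact h11

lemma density_eq_factor (ha : 2 < a ^ 2) (t : ℝ) :
    (Waζ a ζ).density t = densityFactor a ζ t * (densityFactor a ζ t)ᵀ := by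
  have h11 : 0 < (Waζ a ζ).density t 1 1 := by
    by_cases ht : t = 0
    · rw [ht, density_zero]
      simp [Mmat]
    · rw [density_of_ne ht, Matrix.smul_apply, smul_eq_mul]
      have := Wa_one_one_pos ha t
      positivity
  have hdet : 0 ≤ ((Waζ a ζ).density t).det := by
    by_cases ht : t = 0
    · rw [ht, density_zero]
      simp [Mmat]
    · rw [density_of_ne ht, Matrix.det_smul]
      have := det_Wa_pos ha t
      positivity
  have hs : (Waζ a ζ).density t 1 0 = (Waζ a ζ).density t 0 1 :=
    congrFun (congrFun (density_transpose t) 0) 1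
  have hq := Real.sq_sqrt h11.le
  have hq' := Real.sq_sqrt (div_nonneg hdet h11.le)
  have hq0 := (Real.sqrt_pos.2 h11).ne'
  apply matrix_two_ext <;>
    simp only [densityFactor, Matrix.mul_apply, Fin.sum_univ_two, Matrix.transpose_apply,
      Matrix.of_apply, Matrix.cons_val', Matrix.cons_val_zero, Matrix.cons_val_one,
      Matrix.cons_val_fin_one, zero_mul, mul_zero, zero_add]
  · rw [← sq, hq', div_mul_div_comm, ← sq (Real.sqrt _), hq, Matrix.det_fin_two, hs]
    field_simp
    ring
  · rw [div_mul_cancel₀ _ hq0]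
  · rw [mul_div_cancel₀ _ hq0, hs]
  · rw [← sq, hq]

theorem denseInL2_excSpace (ha : 2 < a ^ 2) (hζ : 0 ≤ ζ) :
    (Waζ a ζ).DenseInL2 (excSpace a) := by
  refine denseInL2_of_factor (measurable_densityFactor ha) (density_eq_factor ha)
    (fun f hf k => ?_) (q := pPoly a ^ 2) (fun t => ?_) (mul_sq_mem_excSpace ha)
  · obtain ⟨G, hG, h⟩ := gaussGrowth_Wa ha
    refine (integral_base hζ (hf.mul (hG k k)).integrable_gaussian fun t ht => ?_).1
    rw [density_of_ne ht, h, Matrix.smul_apply, Matrix.smul_apply, smul_eq_mul, smul_eq_mul]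
    ring
  · rw [eval_pow, eval_pPoly]
    exact pow_ne_zero 2 (pfun_ne_zero ha t)

end Complete

/-! ### The exceptional orthogonal polynomials -/

section Conclusion

variable {a ζ : ℝ}

lemma leftSpan_eq_excSpace {P : ℕ → MatPoly 2}
    (hP : ∀ k, k ≠ 1 → P k ∈ excSpace a ∧ (P k).natDegree = k ∧ IsUnit (P k).leadingCoeff) :
    leftSpan {1} P = excSpace a :=
  span_eq_of_degree (fun _ hQ h0 => natDegree_notMem_of_mem_excSpace hQ h0) hP

lemma Da_F2_ne_zero (ha : 2 < a ^ 2) : (Da a).F2 ≠ 0 := by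
  intro h
  have h1 := congrFun (congrFun (congrFun h 1) 1) 1
  have hp := pfun_ne_zero ha 1
  simp [Da] at h1
  exact hp h1

theorem isExceptional_orthP (ha : 2 < a ^ 2) (hζ : 0 ≤ ζ) :
    IsExceptional {1} (Waζ a ζ) (Da a) (orthP a ζ) where
  degree n hn := (orthP_basis ha hζ n (by simpa using hn)).2
  weight := isWeight_Waζ ha hζ
  orthogonal n hn k hk hnk := by
    rw [Finset.mem_singleton] at hn hk
    rcases lt_or_gt_of_ne hnk with h | h
    · have := (orthP_spec ha hζ k hk).2.2.2 n h hn
      rw [← polyInner_transpose, Matrix.transpose_eq_zero] at this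
      exact this
    · exact (orthP_spec ha hζ n hn).2.2.2 k h hk
  norm_posDef n hn := polyInner_posDef ha hζ (orthP_basis ha hζ n (by simpa using hn)).2.2
  complete := by
    rw [Finset.coe_singleton, leftSpan_eq_excSpace fun k hk => orthP_basis ha hζ k hk]
    exact denseInL2_excSpace ha hζ
  order_two := Da_F2_ne_zero ha
  rational := ⟨isRegularRational_F2 ha, isRegularRational_F1 ha, isRegularRational_F0 a⟩
  eigen n hn := exists_eigenvalue_orthP ha hζ (by simpa using hn)

theorem isSymmetricOn_excSpace (ha : 2 < a ^ 2) (hζ : 0 ≤ ζ) :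
    IsSymmetricOn (Da a) (Waζ a ζ) (excSpace a) := by
  refine ⟨fun P hP => ?_, fun P _ Q _ => inner_app ha hζ P Q⟩
  obtain ⟨Q, -, -, h⟩ := exists_app_eq_value ha (P.natDegree + 1) hP
    (degree_le_natDegree.trans_lt (by exact_mod_cast Nat.lt_succ_self _))
  exact ⟨Q, h⟩

lemma orthP_mem_span_excP (ha : 2 < a ^ 2) (hζ : 0 ≤ ζ) {n : ℕ} (hn : n ≠ 1) :
    orthP a ζ n ∈ Submodule.span (Matrix (Fin 2) (Fin 2) ℝ) (excP a '' {k | k ≤ n ∧ k ≠ 1}) := by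
  obtain ⟨hm, hd, -⟩ := orthP_basis ha hζ n hn
  have h := mem_span_of_degree_lt (fun Q hQ h0 => natDegree_notMem_of_mem_excSpace hQ h0)
    (fun k hk => excP_basis ha k hk) (n + 1) _ hm
    (degree_le_natDegree.trans_lt (by rw [hd]; exact_mod_cast Nat.lt_succ_self n))
  refine Submodule.span_mono (Set.image_mono fun k (hk : k < n + 1 ∧ k ∉ ({1} : Set ℕ)) => ?_) h
  exact ⟨Nat.lt_succ_iff.1 hk.1, hk.2⟩

end Conclusion

end ExceptionalMatrix

theorem mainTheorem9 (a ζ : ℝ) (ha : 2 < a ^ 2) (hζ : 0 ≤ ζ) :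
    (∀ t : ℝ, ExceptionalMatrix.pfun a t ≠ 0) ∧
    (∀ i j : Fin 2, MeasureTheory.Integrable (fun t => ExceptionalMatrix.Wa a t i j)) ∧
    (∀ Ω : Set ℝ, MeasurableSet Ω →
      (ExceptionalMatrix.Waζ a ζ).mass Ω =
        (1 / Real.sqrt Real.pi) •
            Matrix.of (fun i j : Fin 2 => ∫ t in Ω, ExceptionalMatrix.Wa a t i j) +
          ζ • Set.indicator Ω (fun _ => ExceptionalMatrix.Mmat) 0) ∧
    ExceptionalMatrix.IsSymmetricOn (ExceptionalMatrix.Da a) (ExceptionalMatrix.Waζ a ζ)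
      (ExceptionalMatrix.leftSpan {1} (ExceptionalMatrix.excP a)) ∧
    ∃ P : ℕ → ExceptionalMatrix.MatPoly 2,
      ExceptionalMatrix.IsExceptional {1} (ExceptionalMatrix.Waζ a ζ)
        (ExceptionalMatrix.Da a) P ∧
      (∀ n, n ≠ 1 → (P n).Monic) ∧
      (∀ n, n ≠ 1 → P n ∈ Submodule.span (Matrix (Fin 2) (Fin 2) ℝ)
        (ExceptionalMatrix.excP a '' {k | k ≤ n ∧ k ≠ 1})) ∧
      ExceptionalMatrix.leftSpan {1} P =
        ExceptionalMatrix.leftSpan {1} (ExceptionalMatrix.excP a) ∧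
      (ζ = 0 → ∀ n, n ≠ 1 → ∃ K : Matrix (Fin 2) (Fin 2) ℝ,
        IsUnit K ∧ P n = K • ExceptionalMatrix.excP a n) ∧
      (∀ t : ℝ, ExceptionalMatrix.value (P 0) t = 1) ∧
      (∀ t : ℝ, ExceptionalMatrix.value (P 2) t =
        !![t ^ 2 - (a ^ 2 + 2) / (2 * a ^ 2 - 4), -a * t;
           2 * a * t / (a ^ 2 - 2), t ^ 2 + 1 / (2 * (ζ * (a ^ 2 - 2) ^ 2 + 1))]) ∧
      (∀ t : ℝ, ExceptionalMatrix.value (P 3) t =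
        !![t ^ 3 - 3 * a ^ 2 * t / (2 * a ^ 2 - 4), -3 * a * t ^ 2 / 2;
           6 * a * t ^ 2 / (a ^ 4 - 4), t ^ 3 + 3 * a ^ 2 * t / (2 * a ^ 2 + 4)]) := by
  refine ⟨ExceptionalMatrix.pfun_ne_zero ha, ExceptionalMatrix.integrable_Wa ha,
    fun _ hΩ => ExceptionalMatrix.mass_Waζ ha hζ hΩ, ?_, ExceptionalMatrix.orthP a ζ,
    ExceptionalMatrix.isExceptional_orthP ha hζ,
    fun n hn => (ExceptionalMatrix.orthP_spec ha hζ n hn).1,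
    fun n hn => ExceptionalMatrix.orthP_mem_span_excP ha hζ hn, ?_, ?_, fun t => ?_,
    ExceptionalMatrix.value_orthP_two ha hζ, ExceptionalMatrix.value_orthP_three ha hζ⟩
  · rw [ExceptionalMatrix.leftSpan_eq_excSpace (ExceptionalMatrix.excP_basis ha)]
    exact ExceptionalMatrix.isSymmetricOn_excSpace ha hζ
  · rw [ExceptionalMatrix.leftSpan_eq_excSpace (ExceptionalMatrix.orthP_basis ha hζ),
      ExceptionalMatrix.leftSpan_eq_excSpace (ExceptionalMatrix.excP_basis ha)]
  · rintro rfl n hn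
    exact ExceptionalMatrix.orthP_zero_mass ha n hn
  · rw [ExceptionalMatrix.orthP_zero, ExceptionalMatrix.value_one]
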